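/- Identify each triple $(x,y,z)\in\mathbb Z^3$ with the unit cube $[x,x+1]\times[y,y+1]\times[z,z+1]$, which is called white if $x+y+z$ is even and black if it is odd. A domino is the union of two such cubes that share a face; for a domino $d$, let $v(d)\in\{\pm e_x,\pm e_y,\pm e_z\}$ be the centre of its black cube minus the centre of its white cube. A tiling of a box $[0,L]\times[0,M]\times[0,N]$ is a set of dominoes with pairwise disjoint interiors whose union is the box. For a unit vector $u\in\{\pm e_x,\pm e_y,\pm e_z\}$, the $u$-shade of a domino $d$ is $S^u(d)=\operatorname{int}\bigl((d+[0,\infty)u)\setminus d\bigr)$, and for two dominoes $d_0,d_1$ put $\tau^u(d_0,d_1)=\frac14\det(v(d_1),v(d_0),u)$ if $d_1\cap S^u(d_0)\neq\emptyset$, and $\tau^u(d_0,d_1)=0$ otherwise. The twist of a tiling $t$ of a box is $\mathrm{Tw}(t)=\sum_{d_0,d_1\in t}\tau^{e_z}(d_0,d_1)$ (for tilings of boxes, replacing $e_z$ by $e_x$ or $e_y$ gives the same value). For nonnegative integers $L,M,N$, at least one of them even, let $\mathrm{maxtw}(L,M,N)$ be the maximum of $\mathrm{Tw}(t)$ over all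 tilings $t$ of $[0,L]\times[0,M]\times[0,N]$. (i) For every fixed integer $N\ge 2$, $$\lim_{L,M\to\infty}\frac{\mathrm{maxtw}(L,M,N)}{LMN^2}=\frac{\lceil N/2\rceil\lfloor N/2\rfloor}{4N^2},$$ where the limit is taken over pairs of positive integers $(L,M)$, tending to infinity independently, such that at least one of $L,M,N$ is even. (ii) $$\lim_{\substack{N,\lambda,\mu\to\infty\\ L=\lfloor\lambda N\rfloor,\ M=\lfloor\mu N\rfloor}}\frac{\mathrm{maxtw}(L,M,N)}{LMN^2}=\frac1{16},$$ where the limit is taken over integers $N$ and real numbers $\lambda,\mu$, tending to infinity independently, such that at least one of $L,M,N$ is even. -/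

import Mathlib

open Filter Topology

noncomputable section

namespace DominoBrick

/-- A vector of `ℤ³`. -/
abbrev Vec : Type := Fin 3 → ℤ

/-- A basic cube, encoded by its lowest corner: `(x, y, z)` stands for
`[x, x+1] × [y, y+1] × [z, z+1]`. -/
abbrev Cube : Type := Fin 3 → ℤ

/-- A basic cube `(x, y, z)` is white if `x + y + z` is even (and black otherwise). -/
def Cube.IsWhite (c : Cube) : Prop := Even (c 0 + c 1 + c 2)

/-- The canonical basis vectors `e_x, e_y, e_z`, as `e 0, e 1, e 2`. -/
def e (i : Fin 3) : Vec := Pi.single i 1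

/-- The set `{± e_x, ± e_y, ± e_z}`. -/
def Phi : Set Vec := {u | ∃ i, u = e i ∨ u = -e i}

/-- A domino: the union of two basic cubes that share a face. Such cubes have opposite colours,
so a domino is given by its white cube and its black cube. -/
@[ext]
structure Domino where
  white : Cube
  black : Cube
  isWhite : white.IsWhite
  adjacent : black - white ∈ Phi

/-- The two basic cubes of a domino. -/
def Domino.cubes (d : Domino) : Finset Cube := {d.white, d.black}

/-- The centre of the black cube of `d` minus the centre of the white one. -/
def Domino.v (d : Domino) : Vec := d.black - d.white

/-- `det (a, b, c) = a · (b × c)`. -/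
def det3 (a b c : Vec) : ℤ := Matrix.det (Matrix.of ![a, b, c])

/-- The cubes that make up the `u`-shade of a union `X` of basic cubes: the cubes of
`X + [0, ∞) u` that are not cubes of `X`. -/
def shade (u : Vec) (X : Finset Cube) : Set Cube :=
  {c | c ∉ X ∧ ∃ c₀ ∈ X, ∃ k : ℕ, c = c₀ + k • u}

open Classical in
/-- The effect of `d₀` on `d₁` along `u`: it is `det (v d₁, v d₀, u) / 4` if `d₁` meets the
(open) `u`-shade of `d₀`, and `0` otherwise. A union of basic cubes meets the open shade if and
only if one of its cubes belongs to the shade. -/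
def effect (u : Vec) (d₀ d₁ : Domino) : ℝ :=
  if ∃ c ∈ d₁.cubes, c ∈ shade u d₀.cubes then (det3 d₁.v d₀.v u : ℝ) / 4 else 0

/-- The `u`-pretwist of a set of dominoes. -/
def pretwist (u : Vec) (t : Finset Domino) : ℝ :=
  ∑ d₀ ∈ t, ∑ d₁ ∈ t, effect u d₀ d₁

/-- The twist of a tiling of a box. The pretwists of such a tiling along `e_x`, `e_y` and `e_z`
coincide; the value along `e_z` is used. -/
def twist (t : Finset Domino) : ℝ := pretwist (e 2) t

/-- `t` is a tiling of the region `R` (a finite union of basic cubes): its dominoes have pairwise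
disjoint interiors, and their union is `R`. -/
def IsTiling (R : Finset Cube) (t : Finset Domino) : Prop :=
  (t : Set Domino).PairwiseDisjoint Domino.cubes ∧ t.biUnion Domino.cubes = R

/-- The box `[0, L] × [0, M] × [0, N]`. -/
def box (L M N : ℕ) : Finset Cube :=
  Fintype.piFinset fun i => Finset.Ico (0 : ℤ) ((![L, M, N] i : ℕ) : ℤ)

/-- The set of the twists of all tilings of the box `[0, L] × [0, M] × [0, N]`. -/
def twistSet (L M N : ℕ) : Set ℝ := {x | ∃ t, IsTiling (box L M N) t ∧ twist t = x}

/-- The maximum of the twist over all tilings of the box `[0, L] × [0, M] × [0, N]`. It is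
attained whenever the box has a tiling, that is, whenever `L`, `M` or `N` is even
(`isGreatest_maxtw`). -/
def maxtw (L M N : ℕ) : ℝ := sSup (twistSet L M N)

lemma finite_tilings (R : Finset Cube) : {t | IsTiling R t}.Finite := by
  classical
  have hD : {d : Domino | d.cubes ⊆ R}.Finite := by
    have h : Set.InjOn (fun d : Domino => (d.white, d.black)) {d : Domino | d.cubes ⊆ R} := by
      intro a _ b _ hab
      simp only [Prod.mk.injEq] at hab
      exact Domino.ext hab.1 hab.2
    refine Set.Finite.of_finite_image (f := fun d : Domino => (d.white, d.black)) ?_ h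
    refine (R ×ˢ R).finite_toSet.subset ?_
    rintro _ ⟨d, hd, rfl⟩
    simp only [Finset.coe_product, Set.mem_prod, Finset.mem_coe]
    exact ⟨hd (by simp [Domino.cubes]), hd (by simp [Domino.cubes])⟩
  refine (hD.toFinset.powerset.finite_toSet).subset ?_
  intro t ht
  simp only [Finset.coe_powerset, Set.mem_preimage, Set.mem_powerset_iff, Set.Finite.coe_toFinset]
  intro d hd c hc
  rw [← ht.2]
  exact Finset.mem_biUnion.2 ⟨d, hd, hc⟩

lemma exists_isTiling_box (L M N : ℕ) (h : Even L ∨ Even M ∨ Even N) :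
    ∃ t, IsTiling (box L M N) t := by
  classical
  obtain ⟨i, k, hi⟩ : ∃ (i : Fin 3) (k : ℕ), ![L, M, N] i = 2 * k := by
    rcases h with h | h | h <;> obtain ⟨k, hk⟩ := h
    · exact ⟨0, k, by simp [hk]; ring⟩
    · exact ⟨1, k, by simp [hk]; ring⟩
    · exact ⟨2, k, by simp [hk]; ring⟩
  have hsum : ∀ c : Cube, (c + e i) 0 + (c + e i) 1 + (c + e i) 2 = c 0 + c 1 + c 2 + 1 := by
    intro c
    fin_cases i <;> simp [e] <;> ring
  have hei : e i i = 1 := by simp [e]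
  have hej : ∀ j, j ≠ i → e i j = 0 := fun j hj => by simp [e, hj]
  let D : Cube → Domino := fun c =>
    if hc : c.IsWhite then ⟨c, c + e i, hc, ⟨i, Or.inl (by simp)⟩⟩
    else ⟨c + e i, c, by
      unfold Cube.IsWhite at hc ⊢
      rw [hsum, Int.even_add_one]; exact hc, ⟨i, Or.inr (by simp)⟩⟩
  have hD : ∀ c x, x ∈ (D c).cubes ↔ x = c ∨ x = c + e i := by
    intro c x
    by_cases hc : c.IsWhite
    · simp [D, hc, Domino.cubes]
    · simp [D, hc, Domino.cubes, or_comm]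
  have key : ∀ a b : Cube, Even (a i) → Even (b i) → ∀ x, (x = a ∨ x = a + e i) →
      (x = b ∨ x = b + e i) → a = b := by
    intro a b ha hb x hxa hxb
    have hab : a i = b i := by
      obtain ⟨p, hp⟩ := ha
      obtain ⟨q, hq⟩ := hb
      rcases hxa with h1 | h1 <;> rcases hxb with h2 | h2 <;>
        · have h3 := congrFun (h1.symm.trans h2) i
          try simp only [Pi.add_apply, hei] at h3
          omega
    have hxj : ∀ c : Cube, (x = c ∨ x = c + e i) → ∀ j, j ≠ i → x j = c j := by
      intro c hc j hj
      rcases hc with h1 | h1 <;> rw [h1]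
      rw [Pi.add_apply, hej j hj, add_zero]
    funext j
    by_cases hj : j = i
    · rw [hj, hab]
    · rw [← hxj a hxa j hj, hxj b hxb j hj]
  have hmem : ∀ c : Cube, c ∈ box L M N ↔ ∀ j, 0 ≤ c j ∧ c j < ((![L, M, N] j : ℕ) : ℤ) := by
    intro c
    simp only [box, Fintype.mem_piFinset, Finset.mem_Ico]
  refine ⟨((box L M N).filter fun c => Even (c i)).image D, ?_, ?_⟩
  · intro d hd d' hd' hne
    simp only [Finset.coe_image, Set.mem_image, Finset.mem_coe, Finset.mem_filter] at hd hd'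
    obtain ⟨a, ha, rfl⟩ := hd
    obtain ⟨b, hb, rfl⟩ := hd'
    refine Finset.disjoint_left.2 fun x hxa hxb => hne ?_
    rw [key a b ha.2 hb.2 x ((hD a x).1 hxa) ((hD b x).1 hxb)]
  · ext x
    simp only [Finset.mem_biUnion, Finset.mem_image, Finset.mem_filter]
    constructor
    · rintro ⟨_, ⟨c, ⟨hc, p, hp⟩, rfl⟩, hx⟩
      rcases (hD c x).1 hx with rfl | rfl
      · exact hc
      · rw [hmem] at hc ⊢
        intro j
        have := hc j
        by_cases hj : j = i
        · subst hj
          rw [hi] at this ⊢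
          simp only [Pi.add_apply, hei]
          push_cast at this ⊢
          omega
        · simpa [hej j hj] using this
    · intro hx
      by_cases hp : Even (x i)
      · exact ⟨D x, ⟨x, ⟨hx, hp⟩, rfl⟩, (hD _ _).2 (Or.inl rfl)⟩
      · refine ⟨D (x - e i), ⟨x - e i, ⟨?_, ?_⟩, rfl⟩, (hD _ _).2 (Or.inr (by simp))⟩
        · rw [hmem] at hx ⊢
          intro j
          have := hx j
          by_cases hj : j = i
          · subst hj
            rw [Int.not_even_iff_odd] at hp
            obtain ⟨q, hq⟩ := hp
            simp only [Pi.sub_apply, hei]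
            omega
          · simpa [hej j hj] using this
        · simp only [Pi.sub_apply, hei]
          rw [Int.not_even_iff_odd] at hp
          exact hp.sub_odd odd_one

/-- If `L`, `M` or `N` is even, then `maxtw L M N` is a genuine maximum. -/
lemma isGreatest_maxtw (L M N : ℕ) (h : Even L ∨ Even M ∨ Even N) :
    IsGreatest (twistSet L M N) (maxtw L M N) := by
  have hfin : (twistSet L M N).Finite := (finite_tilings (box L M N)).image twist
  obtain ⟨t, ht⟩ := exists_isTiling_box L M N h
  exact ⟨Set.Nonempty.csSup_mem ⟨_, t, ht, rfl⟩ hfin,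
    fun _ hx => le_csSup hfin.bddAbove hx⟩

end DominoBrick

end

/-! The determinant with `e_z` sees only horizontal parts, and two perpendicular horizontal dominoes
have at most one column in common. So four times the twist is a sum over columns, each contributing
the cross products of its pairs of cubes (`twist_eq_sum_columnTwist`). A column with `A` cubes along
`x` and `B` along `y` contributes at most `A * B ≤ ⌊N/2⌋⌈N/2⌉` in absolute value
(`abs_columnTwist_le`); this upper bound is already the limit.

For the lower bound almost every column must be extremal: with `p = ⌊N/2⌋` and `q = ⌈N/2⌉`, the `q`
lower floors point along `σ e_y` and the `p` upper floors along `σ e_x`, for one sign `σ`. A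
permutation moving every cube to a neighbour yields a tiling (`exists_isTiling_of_perm`), so it
suffices to route closed lines of cubes. Columns are grouped into `p × q` blocks, the vertices of a
coarse grid. North-south bundles use the lower floors, east-west bundles the upper ones; each
consists of `p * q` lines. Two bundles cross freely, and one bundle turns by passing through the `p
× q` interface between the floors (`exists_isTiling_of_flow`).

The coarse flow comes from a stream function made of ridges along the diagonals `y - x = c`. On a
slope it depends on `y - x` only, so north and east flows have equal sign, as wanted. Each ridge
closes up into an elongated ring inside the rectangle (`legal_flow`, `flow_support`). Only 12 of
every `4W + 4` diagonals are lost (`le_card_goodVertices`), besides a boundary margin; bad columns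
cost at most the extremal amount. The estimate is uniform in `N` once `L, M ≥ K * N`
(`exists_bound_maxtw`), which gives both limits. -/

namespace DominoBrick

/-! ### The twist as a sum over columns -/

/-- The determinant of the horizontal parts of two vectors. -/
def cross (a b : Vec) : ℤ := a 0 * b 1 - a 1 * b 0

lemma det3_e_two (a b : Vec) : det3 a b (e 2) = cross a b := by
  simp [det3, cross, Matrix.det_fin_three, e]

/-- The cube `c₁` lies strictly above `c₀` in the same column. -/
def Above (c₀ c₁ : Cube) : Prop := c₁ 0 = c₀ 0 ∧ c₁ 1 = c₀ 1 ∧ c₀ 2 < c₁ 2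

instance (c₀ c₁ : Cube) : Decidable (Above c₀ c₁) := by unfold Above; infer_instance

lemma Domino.exists_smul_of_mem_cubes {d : Domino} {c c' : Cube} (hc : c ∈ d.cubes)
    (hc' : c' ∈ d.cubes) : ∃ k : ℤ, c' - c = k • d.v := by
  simp only [Domino.cubes, Finset.mem_insert, Finset.mem_singleton] at hc hc'
  rcases hc with rfl | rfl <;> rcases hc' with rfl | rfl
  · exact ⟨0, by simp⟩
  · exact ⟨1, by simp [Domino.v]⟩
  · exact ⟨-1, by simp [Domino.v]⟩
  · exact ⟨0, by simp⟩

/-- A second pair in a common column would differ from the first by multiples of `d₀.v` and `d₁.v`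
with equal horizontal parts; these parts are independent, so both multiples vanish. -/
lemma above_unique {d₀ d₁ : Domino} (hx : cross d₁.v d₀.v ≠ 0) {c₀ c₀' c₁ c₁' : Cube}
    (h₀ : c₀ ∈ d₀.cubes) (h₀' : c₀' ∈ d₀.cubes) (h₁ : c₁ ∈ d₁.cubes) (h₁' : c₁' ∈ d₁.cubes)
    (h : Above c₀ c₁) (h' : Above c₀' c₁') : c₀' = c₀ ∧ c₁' = c₁ := by
  obtain ⟨k, hk⟩ := Domino.exists_smul_of_mem_cubes h₀ h₀'
  obtain ⟨l, hl⟩ := Domino.exists_smul_of_mem_cubes h₁ h₁'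
  have k0 := congrFun hk 0
  have k1 := congrFun hk 1
  have l0 := congrFun hl 0
  have l1 := congrFun hl 1
  simp only [Pi.sub_apply, Pi.smul_apply, smul_eq_mul] at k0 k1 l0 l1
  obtain ⟨a0, a1, -⟩ := h
  obtain ⟨b0, b1, -⟩ := h'
  have e0 : k * d₀.v 0 = l * d₁.v 0 := by linarith
  have e1 : k * d₀.v 1 = l * d₁.v 1 := by linarith
  have hk0 : k * cross d₁.v d₀.v = 0 := by
    unfold cross; linear_combination d₁.v 0 * e1 - d₁.v 1 * e0
  have hl0 : l * cross d₁.v d₀.v = 0 := by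
    unfold cross; linear_combination d₀.v 0 * e1 - d₀.v 1 * e0
  have hk' := (mul_eq_zero.1 hk0).resolve_right hx
  have hl' := (mul_eq_zero.1 hl0).resolve_right hx
  subst hk' hl'
  rw [zero_smul, sub_eq_zero] at hk hl
  exact ⟨hk, hl⟩

lemma mem_shade_iff_above {d₀ d₁ : Domino} (hd : Disjoint d₀.cubes d₁.cubes) :
    (∃ c ∈ d₁.cubes, c ∈ shade (e 2) d₀.cubes) ↔
      ∃ c₀ ∈ d₀.cubes, ∃ c₁ ∈ d₁.cubes, Above c₀ c₁ := by
  constructor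
  · rintro ⟨c, hc, hn, c₀, h₀, k, rfl⟩
    refine ⟨c₀, h₀, _, hc, ?_⟩
    have hk : k ≠ 0 := by rintro rfl; simp at hn; exact hn h₀
    simp [Above, e]
    omega
  · rintro ⟨c₀, h₀, c₁, h₁, a0, a1, a2⟩
    refine ⟨c₁, h₁, fun h => Finset.disjoint_left.1 hd h h₁, c₀, h₀, (c₁ 2 - c₀ 2).toNat, ?_⟩
    funext i
    fin_cases i <;> simp [e] <;> omega

/-- By `above_unique` the double sum has at most one term whenever the determinant is nonzero, so
counting pairs of cubes agrees with the indicator of meeting the shade. -/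
lemma effect_eq_sum {d₀ d₁ : Domino} (hd : d₀ ≠ d₁ → Disjoint d₀.cubes d₁.cubes) :
    effect (e 2) d₀ d₁ = ∑ c₀ ∈ d₀.cubes, ∑ c₁ ∈ d₁.cubes,
      if Above c₀ c₁ then (cross d₁.v d₀.v : ℝ) / 4 else 0 := by
  unfold effect
  rw [det3_e_two]
  by_cases hx : cross d₁.v d₀.v = 0
  · simp [hx]
  have hne : d₀ ≠ d₁ := by rintro rfl; apply hx; unfold cross; ring
  simp only [mem_shade_iff_above (hd hne)]
  split_ifs with h
  · obtain ⟨c₀, h₀, c₁, h₁, ha⟩ := h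
    rw [Finset.sum_eq_single_of_mem c₀ h₀, Finset.sum_eq_single_of_mem c₁ h₁, if_pos ha]
    · intro b hb hbc
      exact if_neg fun hab => hbc (above_unique hx h₀ h₀ h₁ hb ha hab).2
    · intro b hb hbc
      exact Finset.sum_eq_zero fun c hc =>
        if_neg fun hab => hbc (above_unique hx h₀ hb h₁ hc ha hab).1
  · push Not at h
    exact (Finset.sum_eq_zero fun c hc => Finset.sum_eq_zero fun c' hc' =>
      if_neg (h c hc c' hc')).symm

/-- The twist as a sum over pairs of cubes lying in a common column. -/
lemma twist_eq_sum {R : Finset Cube} {t : Finset Domino} (ht : IsTiling R t) {V : Cube → Vec}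
    (hV : ∀ d ∈ t, ∀ c ∈ d.cubes, V c = d.v) :
    twist t = ∑ c₀ ∈ R, ∑ c₁ ∈ R, if Above c₀ c₁ then (cross (V c₁) (V c₀) : ℝ) / 4 else 0 := by
  rw [← ht.2, Finset.sum_biUnion ht.1]
  refine Finset.sum_congr rfl fun d₀ h₀ => ?_
  simp only [Finset.sum_biUnion ht.1]
  rw [Finset.sum_comm]
  refine Finset.sum_congr rfl fun d₁ h₁ => ?_
  rw [effect_eq_sum (ht.1 h₀ h₁)]
  refine Finset.sum_congr rfl fun c₀ hc₀ => Finset.sum_congr rfl fun c₁ hc₁ => ?_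
  rw [hV _ h₀ _ hc₀, hV _ h₁ _ hc₁]

lemma mem_box {L M N : ℕ} {c : Cube} : c ∈ box L M N ↔
    (0 ≤ c 0 ∧ c 0 < L) ∧ (0 ≤ c 1 ∧ c 1 < M) ∧ (0 ≤ c 2 ∧ c 2 < N) := by
  simp only [box, Fintype.mem_piFinset, Finset.mem_Ico, Fin.forall_fin_succ]
  simp

lemma sum_box (L M N : ℕ) (F : Cube → ℝ) : ∑ c ∈ box L M N, F c =
    ∑ x ∈ Finset.Ico (0 : ℤ) L, ∑ y ∈ Finset.Ico (0 : ℤ) M, ∑ z ∈ Finset.Ico (0 : ℤ) N,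
      F ![x, y, z] := by
  rw [← Finset.sum_product', ← Finset.sum_product']
  refine Finset.sum_bij' (fun c _ => ((c 0, c 1), c 2)) (fun c _ => ![c.1.1, c.1.2, c.2])
    ?_ ?_ ?_ ?_ ?_
  · intro c hc
    rw [mem_box] at hc
    simpa [and_assoc] using hc
  · intro c hc
    rw [mem_box]
    simpa [and_assoc] using hc
  · intro c _
    funext i
    fin_cases i <;> rfl
  · intro c _; rfl
  · intro c _
    congr 1
    funext i
    fin_cases i <;> rfl

/-- The contribution (times four) of a column of height `N` to the twist. -/
noncomputable def columnTwist (N : ℕ) (f : ℤ → Vec) : ℤ :=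
  ∑ z₀ ∈ Finset.Ico (0 : ℤ) N, ∑ z₁ ∈ Finset.Ico (0 : ℤ) N,
    if z₀ < z₁ then cross (f z₁) (f z₀) else 0

lemma twist_eq_sum_columnTwist {L M N : ℕ} {t : Finset Domino} (ht : IsTiling (box L M N) t)
    {V : Cube → Vec} (hV : ∀ d ∈ t, ∀ c ∈ d.cubes, V c = d.v) :
    twist t = (∑ x ∈ Finset.Ico (0 : ℤ) L, ∑ y ∈ Finset.Ico (0 : ℤ) M,
      (columnTwist N fun z => V ![x, y, z] : ℝ)) / 4 := by
  rw [twist_eq_sum ht hV, sum_box, Finset.sum_div]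
  refine Finset.sum_congr rfl fun x hx => ?_
  rw [Finset.sum_div]
  refine Finset.sum_congr rfl fun y hy => ?_
  unfold columnTwist
  push_cast
  rw [Finset.sum_div]
  refine Finset.sum_congr rfl fun z hz => ?_
  rw [sum_box, Finset.sum_eq_single_of_mem x hx, Finset.sum_eq_single_of_mem y hy, Finset.sum_div]
  · refine Finset.sum_congr rfl fun z' _ => ?_
    by_cases h : z < z' <;> simp [Above, h]
  · intro y' _ hy'
    exact Finset.sum_eq_zero fun z' _ => if_neg fun h => hy' h.2.1
  · intro x' _ hx'
    exact Finset.sum_eq_zero fun y' _ => Finset.sum_eq_zero fun z' _ => if_neg fun h => hx' h.1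

/-! ### Bounds on the contribution of a column -/

lemma abs_add_abs_le_of_mem_Phi {u : Vec} (hu : u ∈ Phi) : |u 0| + |u 1| ≤ 1 := by
  obtain ⟨i, rfl | rfl⟩ := hu <;> fin_cases i <;> simp [e]

/-- Only products of an `x`-component with a `y`-component occur, each pair of heights at most once,
so the sum is bounded by `A * B`. As `A + B ≤ N`, the integer maximum is at the balanced split. -/
lemma abs_columnTwist_le (N : ℕ) (f : ℤ → Vec)
    (hf : ∀ z ∈ Finset.Ico (0 : ℤ) N, |f z 0| + |f z 1| ≤ 1) :
    |columnTwist N f| ≤ ((N / 2 : ℕ) : ℤ) * ((N - N / 2 : ℕ) : ℤ) := by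
  set S := Finset.Ico (0 : ℤ) N with hS
  set A := ∑ z ∈ S, |f z 0|
  set B := ∑ z ∈ S, |f z 1|
  have hA : 0 ≤ A := Finset.sum_nonneg fun _ _ => abs_nonneg _
  have hB : 0 ≤ B := Finset.sum_nonneg fun _ _ => abs_nonneg _
  have hAB : A + B ≤ N := by
    rw [← Finset.sum_add_distrib]
    calc _ ≤ ∑ z ∈ S, (1 : ℤ) := Finset.sum_le_sum hf
      _ = N := by simp [hS]
  have h1 : |columnTwist N f| ≤ ∑ z₀ ∈ S, ∑ z₁ ∈ S,
      ((if z₀ < z₁ then |f z₁ 0| * |f z₀ 1| else 0) +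
        if z₀ < z₁ then |f z₁ 1| * |f z₀ 0| else 0) := by
    refine (Finset.abs_sum_le_sum_abs _ _).trans (Finset.sum_le_sum fun z₀ _ => ?_)
    refine (Finset.abs_sum_le_sum_abs _ _).trans (Finset.sum_le_sum fun z₁ _ => ?_)
    split_ifs
    · rw [← abs_mul, ← abs_mul]
      exact abs_sub _ _
    · simp
  have h2 : ∑ z₀ ∈ S, ∑ z₁ ∈ S,
      ((if z₀ < z₁ then |f z₁ 0| * |f z₀ 1| else 0) +
        if z₀ < z₁ then |f z₁ 1| * |f z₀ 0| else 0) ≤ A * B := by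
    simp only [Finset.sum_add_distrib]
    -- After exchanging the first double sum, both families have the same product `|f z₀ 0| * |f z₁
    -- 1|`, under the exclusive conditions `z₁ < z₀` and `z₀ < z₁`.
    rw [Finset.sum_comm, Finset.sum_mul_sum, ← Finset.sum_add_distrib]
    refine Finset.sum_le_sum fun z₀ _ => ?_
    rw [← Finset.sum_add_distrib]
    refine Finset.sum_le_sum fun z₁ _ => ?_
    have := mul_nonneg (abs_nonneg (f z₀ 0)) (abs_nonneg (f z₁ 1))
    split_ifs
    · omega
    · simp
    · simp [mul_comm]
    · simpa using this
  refine h1.trans (h2.trans ?_)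
  have h3 : A * B ≤ A * (N - A) := mul_le_mul_of_nonneg_left (by linarith) hA
  refine h3.trans ?_
  have hN : ((N - N / 2 : ℕ) : ℤ) = N - (N / 2 : ℕ) := by omega
  rw [hN]
  have hN2 : (N : ℤ) = 2 * ((N / 2 : ℕ) : ℤ) ∨ (N : ℤ) = 2 * ((N / 2 : ℕ) : ℤ) + 1 := by omega
  set h : ℤ := ((N / 2 : ℕ) : ℤ)
  rcases hN2 with h2 | h2 <;> rw [h2]
  · nlinarith [sq_nonneg (A - h)]
  · rcases le_or_gt A h with h4 | h4
    · nlinarith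
    · nlinarith [Int.add_one_le_iff.2 h4]

/-- The vector `v` of the domino of `t` that contains a given cube (zero if there is none). -/
noncomputable def vecAt (t : Finset Domino) (c : Cube) : Vec :=
  open Classical in if h : ∃ d ∈ t, c ∈ d.cubes then h.choose.v else 0

lemma vecAt_eq {R : Finset Cube} {t : Finset Domino} (ht : IsTiling R t) {d : Domino} (hd : d ∈ t)
    {c : Cube} (hc : c ∈ d.cubes) : vecAt t c = d.v := by
  have h : ∃ d ∈ t, c ∈ d.cubes := ⟨d, hd, hc⟩
  rw [vecAt, dif_pos h]
  congr 1
  by_contra hne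
  exact Finset.disjoint_left.1 (ht.1 h.choose_spec.1 hd hne) h.choose_spec.2 hc

/-- The default value zero also satisfies the bound, so no membership in the region is needed. -/
lemma abs_vecAt (t : Finset Domino) (c : Cube) : |vecAt t c 0| + |vecAt t c 1| ≤ 1 := by
  unfold vecAt
  split_ifs with h
  · exact abs_add_abs_le_of_mem_Phi h.choose.adjacent
  · simp

lemma twist_eq_sum_columnTwist_vecAt {L M N : ℕ} {t : Finset Domino}
    (ht : IsTiling (box L M N) t) :
    twist t = (∑ x ∈ Finset.Ico (0 : ℤ) L, ∑ y ∈ Finset.Ico (0 : ℤ) M,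
      (columnTwist N fun z => vecAt t ![x, y, z] : ℝ)) / 4 :=
  twist_eq_sum_columnTwist ht fun _ hd _ hc => vecAt_eq ht hd hc

lemma abs_columnTwist_vecAt_le (N : ℕ) (t : Finset Domino) (x y : ℤ) :
    |(columnTwist N (fun z => vecAt t ![x, y, z]) : ℝ)| ≤ (N / 2 : ℕ) * (N - N / 2 : ℕ) := by
  have h := Int.cast_le (R := ℝ).2
    (abs_columnTwist_le N _ fun z _ => abs_vecAt t ![x, y, z])
  simpa only [Int.cast_abs, Int.cast_mul, Int.cast_natCast] using h

lemma twist_le {L M N : ℕ} {t : Finset Domino} (ht : IsTiling (box L M N) t) :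
    twist t ≤ L * M * ((N / 2 : ℕ) * (N - N / 2 : ℕ)) / 4 := by
  rw [twist_eq_sum_columnTwist_vecAt ht]
  gcongr
  calc _ ≤ ∑ x ∈ Finset.Ico (0 : ℤ) L, ∑ y ∈ Finset.Ico (0 : ℤ) M,
        (((N / 2 : ℕ) : ℝ) * (N - N / 2 : ℕ)) :=
        Finset.sum_le_sum fun x _ => Finset.sum_le_sum fun y _ =>
          (abs_le.1 (abs_columnTwist_vecAt_le N t x y)).2
    _ = _ := by simp; ring

/-- If the columns over `G` contribute as much as possible, the twist is large. -/
lemma le_twist {L M N : ℕ} {t : Finset Domino} (ht : IsTiling (box L M N) t)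
    (G : Finset (ℤ × ℤ)) (hG : G ⊆ Finset.Ico (0 : ℤ) L ×ˢ Finset.Ico (0 : ℤ) M)
    (hcol : ∀ g ∈ G, columnTwist N (fun z => vecAt t ![g.1, g.2, z]) =
      ((N / 2 : ℕ) : ℤ) * ((N - N / 2 : ℕ) : ℤ)) :
    (2 * G.card - L * M) * (((N / 2 : ℕ) : ℝ) * (N - N / 2 : ℕ)) / 4 ≤ twist t := by
  rw [twist_eq_sum_columnTwist_vecAt ht]
  gcongr
  rw [← Finset.sum_product', ← Finset.sum_sdiff hG]
  set k : ℝ := ((N / 2 : ℕ) : ℝ) * (N - N / 2 : ℕ)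
  have h1 : ∑ g ∈ G, (columnTwist N (fun z => vecAt t ![g.1, g.2, z]) : ℝ) = G.card * k := by
    rw [Finset.sum_congr rfl fun g hg => by rw [hcol g hg]]
    rw [Finset.sum_const, nsmul_eq_mul, Int.cast_mul, Int.cast_natCast, Int.cast_natCast]
  -- Nothing is known about the other columns; each costs at most `k`, whence the factor `2` in
  -- front of `G.card`.
  have h2 : ∑ g ∈ (Finset.Ico (0 : ℤ) L ×ˢ Finset.Ico (0 : ℤ) M) \ G, (-k) ≤
      ∑ g ∈ (Finset.Ico (0 : ℤ) L ×ˢ Finset.Ico (0 : ℤ) M) \ G,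
        (columnTwist N (fun z => vecAt t ![g.1, g.2, z]) : ℝ) := by
    refine Finset.sum_le_sum fun g _ => ?_
    exact (abs_le.1 (abs_columnTwist_vecAt_le N t g.1 g.2)).1
  have h3 : ((((Finset.Ico (0 : ℤ) L ×ˢ Finset.Ico (0 : ℤ) M) \ G).card : ℕ) : ℝ) =
      L * M - G.card := by
    rw [Finset.card_sdiff_of_subset hG, Nat.cast_sub (Finset.card_le_card hG)]
    simp
  rw [Finset.sum_const, nsmul_eq_mul, h3] at h2
  rw [h1]
  linarith

/-! ### Tilings from permutations and from pairings -/

lemma isWhite_add_iff {c : Cube} {u : Vec} (hu : u ∈ Phi) :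
    Cube.IsWhite (c + u) ↔ ¬ Cube.IsWhite c := by
  have h : (c + u) 0 + (c + u) 1 + (c + u) 2 = c 0 + c 1 + c 2 + 1 ∨
      (c + u) 0 + (c + u) 1 + (c + u) 2 = c 0 + c 1 + c 2 - 1 := by
    obtain ⟨i, rfl | rfl⟩ := hu <;> fin_cases i <;> simp [e] <;> omega
  unfold Cube.IsWhite
  rcases h with h | h <;> rw [h] <;> simp only [Int.even_add_one, Int.even_sub_one]

/-- A permutation `f` of a region that moves each cube to a neighbour gives a tiling: each white
cube is matched with its image. -/
lemma exists_isTiling_of_perm (R : Finset Cube) (f g : Cube → Cube) (hf : ∀ c ∈ R, f c ∈ R)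
    (hg : ∀ c ∈ R, g c ∈ R) (hgf : ∀ c ∈ R, g (f c) = c) (hfg : ∀ c ∈ R, f (g c) = c)
    (hadj : ∀ c ∈ R, f c - c ∈ Phi) :
    ∃ t, IsTiling R t ∧ ∀ c ∈ R, ∃ d ∈ t, c ∈ d.cubes ∧ (d.v = f c - c ∨ d.v = c - g c) := by
  classical
  let D : {c // c ∈ R ∧ c.IsWhite} → Domino := fun c => ⟨c, f c, c.2.2, hadj c c.2.1⟩
  have hblack : ∀ c ∈ R, ¬ Cube.IsWhite c → Cube.IsWhite (g c) := by
    intro c hc hw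
    by_contra h
    have h1 := hadj (g c) (hg c hc)
    rw [hfg c hc] at h1
    have h2 := isWhite_add_iff (c := g c) h1
    rw [add_sub_cancel] at h2
    exact hw (h2.2 h)
  have hwhite : ∀ c ∈ R, Cube.IsWhite c → ¬ Cube.IsWhite (f c) := by
    intro c hc hw h
    have h2 := isWhite_add_iff (c := c) (hadj c hc)
    rw [add_sub_cancel] at h2
    exact h2.1 h hw
  have hcov : ∀ c ∈ R, ∃ w, c ∈ (D w).cubes ∧ ((D w).v = f c - c ∨ (D w).v = c - g c) := by
    intro c hc
    by_cases hw : Cube.IsWhite c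
    · exact ⟨⟨c, hc, hw⟩, by simp [D, Domino.cubes], Or.inl rfl⟩
    -- A black cube belongs to the domino of its preimage, so there `v` is the incoming direction of
    -- the line rather than the outgoing one.
    · refine ⟨⟨g c, hg c hc, hblack c hc hw⟩, by simp [D, Domino.cubes, hfg c hc], Or.inr ?_⟩
      simp [D, Domino.v, hfg c hc]
  have hfin : (Set.range D).Finite := by
    have : Finite {c // c ∈ R ∧ c.IsWhite} :=
      Finite.of_injective (fun c => (⟨c.1, c.2.1⟩ : R)) fun a b h => by
        simpa [Subtype.ext_iff] using h
    exact Set.finite_range D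
  refine ⟨hfin.toFinset, ⟨?_, ?_⟩, ?_⟩
  · intro d hd d' hd' hne
    simp only [Set.Finite.coe_toFinset, Set.mem_range] at hd hd'
    obtain ⟨a, rfl⟩ := hd
    obtain ⟨b, rfl⟩ := hd'
    refine Finset.disjoint_left.2 fun x hxa hxb => hne ?_
    congr 1
    simp only [D, Domino.cubes, Finset.mem_insert, Finset.mem_singleton] at hxa hxb
    apply Subtype.ext
    rcases hxa with hxa | hxa <;> rcases hxb with hxb | hxb
    · rw [← hxa, ← hxb]
    · exact absurd a.2.2 (by rw [← hxa, hxb]; exact hwhite _ b.2.1 b.2.2)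
    · exact absurd b.2.2 (by rw [← hxb, hxa]; exact hwhite _ a.2.1 a.2.2)
    · rw [← hgf a a.2.1, ← hgf b b.2.1, ← hxa, ← hxb]
  · ext x
    simp only [Finset.mem_biUnion, Set.Finite.mem_toFinset, Set.mem_range]
    constructor
    · rintro ⟨_, ⟨c, rfl⟩, hx⟩
      simp only [D, Domino.cubes, Finset.mem_insert, Finset.mem_singleton] at hx
      rcases hx with rfl | rfl
      · exact c.2.1
      · exact hf _ c.2.1
    · intro hx
      obtain ⟨w, hw, -⟩ := hcov x hx
      exact ⟨_, ⟨w, rfl⟩, hw⟩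
  · intro c hc
    obtain ⟨w, hw, hv⟩ := hcov c hc
    exact ⟨_, by simp, hw, hv⟩

lemma IsTiling.union [DecidableEq Domino] {R₁ R₂ : Finset Cube} {t₁ t₂ : Finset Domino}
    (h₁ : IsTiling R₁ t₁) (h₂ : IsTiling R₂ t₂) (hR : Disjoint R₁ R₂) :
    IsTiling (R₁ ∪ R₂) (t₁ ∪ t₂) := by
  have key : ∀ d ∈ t₁, ∀ d' ∈ t₂, Disjoint d.cubes d'.cubes := by
    intro d hd d' hd'
    refine Disjoint.mono ?_ ?_ hR
    · rw [← h₁.2]; exact Finset.subset_biUnion_of_mem Domino.cubes hd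
    · rw [← h₂.2]; exact Finset.subset_biUnion_of_mem Domino.cubes hd'
  constructor
  · rw [Finset.coe_union, Set.pairwiseDisjoint_union]
    exact ⟨h₁.1, h₂.1, fun d hd d' hd' _ => key d hd d' hd'⟩
  · rw [Finset.union_biUnion, h₁.2, h₂.2]

/-- The neighbour of a cube in direction `i`, cubes being paired by the parity of their
coordinate. -/
noncomputable def partner (i : Fin 3) (c : Cube) : Cube :=
  if Even (c i) then c + e i else c - e i

lemma partner_partner (i : Fin 3) (c : Cube) : partner i (partner i c) = c := by
  unfold partner
  by_cases h : Even (c i)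
  · rw [if_pos h, if_neg (by simpa [e, Int.even_add_one] using h), add_sub_cancel_right]
  · rw [if_neg h, if_pos (by simpa [e, Int.even_sub_one] using h), sub_add_cancel]

lemma exists_isTiling_of_partner (R : Finset Cube) (i : Fin 3) (hR : ∀ c ∈ R, partner i c ∈ R) :
    ∃ t, IsTiling R t := by
  obtain ⟨t, ht, -⟩ := exists_isTiling_of_perm R (partner i) (partner i) hR hR
    (fun c _ => partner_partner i c) (fun c _ => partner_partner i c) (fun c _ => by
      unfold partner
      split_ifs
      · exact ⟨i, Or.inl (by simp)⟩
      · exact ⟨i, Or.inr (by simp)⟩)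
  exact ⟨t, ht⟩

/-! ### Bundles of lines over a vertex of the coarse grid -/

/-- The admissible flows `(s, n, w, o)` through a vertex: `s` and `n` are the northward flows along
the southern and northern edge, `w` and `o` the eastward flows along the western and eastern
edge. Either nothing passes, or two lines cross, or one line turns. -/
def Legal (s n w o : ℤ) : Prop :=
  (s = 0 ∧ n = 0 ∧ w = 0 ∧ o = 0) ∨
  ((s = 1 ∧ n = 1 ∨ s = -1 ∧ n = -1) ∧ (w = 1 ∧ o = 1 ∨ w = -1 ∧ o = -1)) ∨
  ((s = 1 ∧ n = 0 ∨ s = 0 ∧ n = -1) ∧ (w = 0 ∧ o = 1 ∨ w = -1 ∧ o = 0)) ∨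
  ((s = -1 ∧ n = 0 ∨ s = 0 ∧ n = 1) ∧ (w = 0 ∧ o = -1 ∨ w = 1 ∧ o = 0))

/-- Where a bundle of lines in the lower floors proceeds north. -/
def GoesNorth (q s n j k : ℤ) : Prop :=
  s = 1 ∧ n = 1 ∨ s = 1 ∧ n = 0 ∧ j + k < q - 1 ∨ s = 0 ∧ n = 1 ∧ k ≤ j

/-- Where a bundle of lines in the lower floors proceeds south. -/
def GoesSouth (q s n j k : ℤ) : Prop :=
  s = -1 ∧ n = -1 ∨ s = 0 ∧ n = -1 ∧ k < j ∨ s = -1 ∧ n = 0 ∧ j + k ≤ q - 1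

/-- Where a bundle of lines in the lower floors proceeds upwards. -/
def LowerUp (q s n j k : ℤ) : Prop :=
  s = 1 ∧ n = 0 ∧ q - 1 ≤ j + k ∨ s = 0 ∧ n = -1 ∧ j ≤ k

/-- Where a bundle of lines in the lower floors proceeds downwards. -/
def LowerDown (q s n j k : ℤ) : Prop :=
  s = 0 ∧ n = 1 ∧ j < k ∨ s = -1 ∧ n = 0 ∧ q - 1 < j + k

/-- Where a bundle of lines in the upper floors proceeds east. -/
def GoesEast (p w o i k : ℤ) : Prop :=
  w = 1 ∧ o = 1 ∨ w = 0 ∧ o = 1 ∧ p - 1 ≤ i + k ∨ w = 1 ∧ o = 0 ∧ i < k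

/-- Where a bundle of lines in the upper floors proceeds west. -/
def GoesWest (p w o i k : ℤ) : Prop :=
  w = -1 ∧ o = -1 ∨ w = -1 ∧ o = 0 ∧ i ≤ k ∨ w = 0 ∧ o = -1 ∧ p - 1 < i + k

/-- Where a bundle of lines in the upper floors proceeds upwards. -/
def UpperUp (p w o i k : ℤ) : Prop :=
  w = 0 ∧ o = 1 ∧ i + k < p - 1 ∨ w = -1 ∧ o = 0 ∧ k < i

/-- Where a bundle of lines in the upper floors proceeds downwards. -/
def UpperDown (p w o i k : ℤ) : Prop :=
  w = 1 ∧ o = 0 ∧ k ≤ i ∨ w = 0 ∧ o = -1 ∧ i + k ≤ p - 1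

open Classical in
/-- The direction of the line through a cube of the lower floors. -/
noncomputable def lowerDir (q s n j k : ℤ) : Vec :=
  if GoesNorth q s n j k then e 1 else if GoesSouth q s n j k then -e 1 else
  if LowerUp q s n j k then e 2 else if LowerDown q s n j k then -e 2 else 0

open Classical in
/-- The direction of the line through a cube of the upper floors. -/
noncomputable def upperDir (p w o i k : ℤ) : Vec :=
  if GoesEast p w o i k then e 0 else if GoesWest p w o i k then -e 0 else
  if UpperUp p w o i k then e 2 else if UpperDown p w o i k then -e 2 else 0

section Directions

variable {p q s n w o i j k : ℤ}

lemma lowerDir_north (h : GoesNorth q s n j k) : lowerDir q s n j k = e 1 := if_pos h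

lemma lowerDir_south (h : GoesSouth q s n j k) : lowerDir q s n j k = -e 1 := by
  rw [lowerDir, if_neg, if_pos h]
  unfold GoesSouth at h; unfold GoesNorth; omega

lemma lowerDir_up (h : LowerUp q s n j k) : lowerDir q s n j k = e 2 := by
  rw [lowerDir, if_neg, if_neg, if_pos h] <;>
  · unfold LowerUp at h; simp only [GoesNorth, GoesSouth]; omega

lemma lowerDir_down (h : LowerDown q s n j k) : lowerDir q s n j k = -e 2 := by
  rw [lowerDir, if_neg, if_neg, if_neg, if_pos h] <;>
  · unfold LowerDown at h; simp only [GoesNorth, GoesSouth, LowerUp]; omega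

lemma upperDir_east (h : GoesEast p w o i k) : upperDir p w o i k = e 0 := if_pos h

lemma upperDir_west (h : GoesWest p w o i k) : upperDir p w o i k = -e 0 := by
  rw [upperDir, if_neg, if_pos h]
  unfold GoesWest at h; unfold GoesEast; omega

lemma upperDir_up (h : UpperUp p w o i k) : upperDir p w o i k = e 2 := by
  rw [upperDir, if_neg, if_neg, if_pos h] <;>
  · unfold UpperUp at h; simp only [GoesEast, GoesWest]; omega

lemma upperDir_down (h : UpperDown p w o i k) : upperDir p w o i k = -e 2 := by
  rw [upperDir, if_neg, if_neg, if_neg, if_pos h] <;>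
  · unfold UpperDown at h; simp only [GoesEast, GoesWest, UpperUp]; omega

end Directions

/-- The direction of the line through a cube, for the flow with northward components `a` (carried
by the `q` lower floors) and eastward components `b` (carried by the `p` upper floors). A vertex
of the coarse grid corresponds to a `p × q` rectangle of columns. -/
noncomputable def flowDir (p q : ℤ) (a b : ℤ → ℤ → ℤ) (c : Cube) : Vec :=
  if c 2 < q then lowerDir q (a (c 0 / p) (c 1 / q - 1)) (a (c 0 / p) (c 1 / q)) (c 1 % q) (c 2)
  else upperDir p (b (c 0 / p - 1) (c 1 / q)) (b (c 0 / p) (c 1 / q)) (c 0 % p) (c 2 - q)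

/-- Some line passes through the vertex below the cube. -/
def Active (p q : ℤ) (a : ℤ → ℤ → ℤ) (c : Cube) : Prop :=
  a (c 0 / p) (c 1 / q - 1) ≠ 0 ∨ a (c 0 / p) (c 1 / q) ≠ 0

/-- Either the step stays in the same block, or it enters the first row of the next one. -/
lemma ediv_emod_add_one {q : ℤ} (hq : 0 < q) (m : ℤ) :
    (m % q < q - 1 ∧ (m + 1) / q = m / q ∧ (m + 1) % q = m % q + 1) ∨
      (m % q = q - 1 ∧ (m + 1) / q = m / q + 1 ∧ (m + 1) % q = 0) := by
  have h0 := Int.emod_nonneg m hq.ne'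
  have h1 := Int.emod_lt_of_pos m hq
  have h2 := Int.mul_ediv_add_emod m q
  rcases lt_or_ge (m % q) (q - 1) with h | h
  · left
    refine ⟨h, (Int.ediv_emod_unique hq).2 ⟨?_, ?_, ?_⟩⟩ <;> linarith
  · right
    refine ⟨by omega, (Int.ediv_emod_unique hq).2 ⟨?_, ?_, ?_⟩⟩
    · have : m % q = q - 1 := by omega
      rw [mul_add]; linarith
    · exact le_rfl
    · exact hq

lemma ediv_emod_sub_one {q : ℤ} (hq : 0 < q) (m : ℤ) :
    (0 < m % q ∧ (m - 1) / q = m / q ∧ (m - 1) % q = m % q - 1) ∨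
      (m % q = 0 ∧ (m - 1) / q = m / q - 1 ∧ (m - 1) % q = q - 1) := by
  have := ediv_emod_add_one hq (m - 1)
  rw [sub_add_cancel] at this
  have h0 := Int.emod_nonneg (m - 1) hq.ne'
  omega

/-- Reversing the flow reverses every line; the reversed flow will supply the inverse permutation.
-/
lemma Legal.neg {s n w o : ℤ} (h : Legal s n w o) : Legal (-s) (-n) (-w) (-o) := by
  rcases h with h | h | h | h
  · exact Or.inl (by omega)
  · exact Or.inr (Or.inl (by omega))
  · exact Or.inr (Or.inr (Or.inr (by omega)))
  · exact Or.inr (Or.inr (Or.inl (by omega)))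

lemma Legal.vertical {s n w o : ℤ} (h : Legal s n w o) :
    s = n ∧ (n = 0 ∨ n = 1 ∨ n = -1) ∨ s = 0 ∧ (n = 1 ∨ n = -1) ∨ n = 0 ∧ (s = 1 ∨ s = -1) := by
  unfold Legal at h; omega

lemma Legal.horizontal {s n w o : ℤ} (h : Legal s n w o) :
    w = o ∧ (o = 0 ∨ o = 1 ∨ o = -1) ∨ w = 0 ∧ (o = 1 ∨ o = -1) ∨ o = 0 ∧ (w = 1 ∨ w = -1) := by
  unfold Legal at h; omega

lemma Legal.active_iff {s n w o : ℤ} (h : Legal s n w o) : (s ≠ 0 ∨ n ≠ 0) ↔ (w ≠ 0 ∨ o ≠ 0) := by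
  unfold Legal at h; omega

section Arithmetic

variable {p q s n n' w o o' i j k : ℤ}

/-- The `inside` and `next` lemmas check that the reversed flow leads back after one step, within a
block and across its boundary respectively. The strict and weak inequalities differ because a corner
cube, lying on a diagonal of the block, carries its outgoing direction, which changes under
reversal. -/
lemma GoesNorth.inside (h : GoesNorth q s n j k) : GoesSouth q (-s) (-n) (j + 1) k := by
  unfold GoesNorth at h; unfold GoesSouth; omega

lemma GoesNorth.next (h : GoesNorth q s n j k) (hj : j = q - 1) (hk : 0 ≤ k) (hk' : k < q)
    (hn : n = n' ∧ (n' = 0 ∨ n' = 1 ∨ n' = -1) ∨ n = 0 ∧ (n' = 1 ∨ n' = -1) ∨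
      n' = 0 ∧ (n = 1 ∨ n = -1)) : GoesSouth q (-n) (-n') 0 k := by
  have : n = 1 := by unfold GoesNorth at h; omega
  unfold GoesSouth; omega

lemma GoesSouth.inside (h : GoesSouth q s n j k) : GoesNorth q (-s) (-n) (j - 1) k := by
  unfold GoesSouth at h; unfold GoesNorth; omega

lemma GoesSouth.next (h : GoesSouth q s n j k) (hj : j = 0) (hk : 0 ≤ k) (hk' : k < q)
    (hn : n' = s ∧ (s = 0 ∨ s = 1 ∨ s = -1) ∨ n' = 0 ∧ (s = 1 ∨ s = -1) ∨
      s = 0 ∧ (n' = 1 ∨ n' = -1)) : GoesNorth q (-n') (-s) (q - 1) k := by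
  have : s = -1 := by unfold GoesSouth at h; omega
  unfold GoesNorth; omega

lemma LowerUp.inside (h : LowerUp q s n j k) : LowerDown q (-s) (-n) j (k + 1) := by
  unfold LowerUp at h; unfold LowerDown; omega

lemma LowerDown.inside (h : LowerDown q s n j k) : LowerUp q (-s) (-n) j (k - 1) := by
  unfold LowerDown at h; unfold LowerUp; omega

/-- Legality of a turn: a vertical bundle that climbs out of the lower floors must leave
horizontally in the upper ones. -/
lemma LowerUp.next (h : LowerUp q s n j k) (hi : 0 ≤ i) (hi' : i < p) (hL : Legal s n w o) :
    UpperDown p (-w) (-o) i 0 := by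
  have : w = 0 ∧ o = 1 ∨ w = -1 ∧ o = 0 := by
    unfold LowerUp at h; unfold Legal at hL; omega
  unfold UpperDown; omega

lemma GoesEast.inside (h : GoesEast p w o i k) : GoesWest p (-w) (-o) (i + 1) k := by
  unfold GoesEast at h; unfold GoesWest; omega

lemma GoesEast.next (h : GoesEast p w o i k) (hi : i = p - 1) (hk : 0 ≤ k) (hk' : k < p)
    (hn : o = o' ∧ (o' = 0 ∨ o' = 1 ∨ o' = -1) ∨ o = 0 ∧ (o' = 1 ∨ o' = -1) ∨
      o' = 0 ∧ (o = 1 ∨ o = -1)) : GoesWest p (-o) (-o') 0 k := by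
  have : o = 1 := by unfold GoesEast at h; omega
  unfold GoesWest; omega

lemma GoesWest.inside (h : GoesWest p w o i k) : GoesEast p (-w) (-o) (i - 1) k := by
  unfold GoesWest at h; unfold GoesEast; omega

lemma GoesWest.next (h : GoesWest p w o i k) (hi : i = 0) (hk : 0 ≤ k) (hk' : k < p)
    (hn : o' = w ∧ (w = 0 ∨ w = 1 ∨ w = -1) ∨ o' = 0 ∧ (w = 1 ∨ w = -1) ∨
      w = 0 ∧ (o' = 1 ∨ o' = -1)) : GoesEast p (-o') (-w) (p - 1) k := by
  have : w = -1 := by unfold GoesWest at h; omega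
  unfold GoesEast; omega

lemma UpperUp.inside (h : UpperUp p w o i k) : UpperDown p (-w) (-o) i (k + 1) := by
  unfold UpperUp at h; unfold UpperDown; omega

lemma UpperDown.inside (h : UpperDown p w o i k) : UpperUp p (-w) (-o) i (k - 1) := by
  unfold UpperDown at h; unfold UpperUp; omega

lemma UpperDown.next (h : UpperDown p w o i k) (hj : 0 ≤ j) (hj' : j < q) (hL : Legal s n w o) :
    LowerUp q (-s) (-n) j (q - 1) := by
  have : s = -1 ∧ n = 0 ∨ s = 0 ∧ n = 1 := by
    unfold UpperDown at h; unfold Legal at hL; omega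
  unfold LowerUp; omega

lemma lower_cases (hL : Legal s n w o) (h : s ≠ 0 ∨ n ≠ 0) :
    GoesNorth q s n j k ∨ GoesSouth q s n j k ∨ LowerUp q s n j k ∨ LowerDown q s n j k := by
  rcases hL.vertical with ⟨hs, hn | hn | hn⟩ | ⟨hs, hn | hn⟩ | ⟨hn, hs | hs⟩
  · omega
  · exact Or.inl (Or.inl ⟨hs.trans hn, hn⟩)
  · exact Or.inr (Or.inl (Or.inl ⟨hs.trans hn, hn⟩))
  · rcases lt_or_ge j k with h | h
    · exact Or.inr (Or.inr (Or.inr (Or.inl ⟨hs, hn, h⟩)))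
    · exact Or.inl (Or.inr (Or.inr ⟨hs, hn, h⟩))
  · rcases lt_or_ge k j with h | h
    · exact Or.inr (Or.inl (Or.inr (Or.inl ⟨hs, hn, h⟩)))
    · exact Or.inr (Or.inr (Or.inl (Or.inr ⟨hs, hn, h⟩)))
  · rcases lt_or_ge (j + k) (q - 1) with h | h
    · exact Or.inl (Or.inr (Or.inl ⟨hs, hn, h⟩))
    · exact Or.inr (Or.inr (Or.inl (Or.inl ⟨hs, hn, h⟩)))
  · rcases lt_or_ge (q - 1) (j + k) with h | h
    · exact Or.inr (Or.inr (Or.inr (Or.inr ⟨hs, hn, h⟩)))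
    · exact Or.inr (Or.inl (Or.inr (Or.inr ⟨hs, hn, h⟩)))

lemma upper_cases (hL : Legal s n w o) (h : w ≠ 0 ∨ o ≠ 0) :
    GoesEast p w o i k ∨ GoesWest p w o i k ∨ UpperUp p w o i k ∨ UpperDown p w o i k := by
  rcases hL.horizontal with ⟨hw, ho | ho | ho⟩ | ⟨hw, ho | ho⟩ | ⟨ho, hw | hw⟩
  · omega
  · exact Or.inl (Or.inl ⟨hw.trans ho, ho⟩)
  · exact Or.inr (Or.inl (Or.inl ⟨hw.trans ho, ho⟩))
  · rcases lt_or_ge (i + k) (p - 1) with h | h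
    · exact Or.inr (Or.inr (Or.inl (Or.inl ⟨hw, ho, h⟩)))
    · exact Or.inl (Or.inr (Or.inl ⟨hw, ho, h⟩))
  · rcases lt_or_ge (p - 1) (i + k) with h | h
    · exact Or.inr (Or.inl (Or.inr (Or.inr ⟨hw, ho, h⟩)))
    · exact Or.inr (Or.inr (Or.inr (Or.inr ⟨hw, ho, h⟩)))
  · rcases lt_or_ge i k with h | h
    · exact Or.inl (Or.inr (Or.inr ⟨hw, ho, h⟩))
    · exact Or.inr (Or.inr (Or.inr (Or.inl ⟨hw, ho, h⟩)))
  · rcases lt_or_ge k i with h | h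
    · exact Or.inr (Or.inr (Or.inl (Or.inr ⟨hw, ho, h⟩)))
    · exact Or.inr (Or.inl (Or.inr (Or.inl ⟨hw, ho, h⟩)))

end Arithmetic

/-! ### Following a line for one step -/

section Flow

variable {p q : ℤ} {a b : ℤ → ℤ → ℤ} {c : Cube}

/-- The result of following the line through a cube for one step, along `u`. -/
def StepsTo (p q : ℤ) (a b : ℤ → ℤ → ℤ) (c : Cube) (u : Vec) : Prop :=
  flowDir p q a b c = u ∧ u ∈ Phi ∧ Active p q a (c + u) ∧ 0 ≤ (c + u) 2 ∧ (c + u) 2 < p + q ∧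
    flowDir p q (-a) (-b) (c + u) = -u

lemma flowDir_of_lt (h : c 2 < q) : flowDir p q a b c =
    lowerDir q (a (c 0 / p) (c 1 / q - 1)) (a (c 0 / p) (c 1 / q)) (c 1 % q) (c 2) := if_pos h

lemma flowDir_of_le (h : q ≤ c 2) : flowDir p q a b c =
    upperDir p (b (c 0 / p - 1) (c 1 / q)) (b (c 0 / p) (c 1 / q)) (c 0 % p) (c 2 - q) :=
  if_neg h.not_gt

variable (hp : 0 < p) (hq : 0 < q)
  (hL : ∀ x y, Legal (a x (y - 1)) (a x y) (b (x - 1) y) (b x y))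
  (h0 : 0 ≤ c 2) (h1 : c 2 < p + q)

include hp hq hL h0

lemma stepsTo_north (hz : c 2 < q)
    (h : GoesNorth q (a (c 0 / p) (c 1 / q - 1)) (a (c 0 / p) (c 1 / q))
      (c 1 % q) (c 2)) : StepsTo p q a b c (e 1) := by
  have e0 : (c + e 1) 0 = c 0 := by simp [e]
  have e1 : (c + e 1) 1 = c 1 + 1 := by simp [e]
  have e2 : (c + e 1) 2 = c 2 := by simp [e]
  refine ⟨(flowDir_of_lt hz).trans (lowerDir_north h), ⟨1, Or.inl rfl⟩, ?_, by omega, by omega, ?_⟩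
  · unfold Active
    rw [e0, e1]
    have hV := (hL (c 0 / p) (c 1 / q)).active_iff
    rcases ediv_emod_add_one hq (c 1) with ⟨d1, d2, d3⟩ | ⟨d1, d2, d3⟩ <;> rw [d2]
    · unfold GoesNorth at h; omega
    · rw [add_sub_cancel_right]; left
      unfold GoesNorth at h; omega
  · rw [flowDir_of_lt (by omega), lowerDir_south]
    rw [e0, e1, e2]
    have m0 := Int.emod_nonneg (c 1) hq.ne'
    have m1 := Int.emod_lt_of_pos (c 1) hq
    rcases ediv_emod_add_one hq (c 1) with ⟨d1, d2, d3⟩ | ⟨d1, d2, d3⟩ <;> rw [d2, d3]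
    · exact h.inside
    · have hN := (hL (c 0 / p) (c 1 / q + 1)).vertical
      rw [add_sub_cancel_right] at hN ⊢
      exact h.next d1 h0 hz hN

lemma stepsTo_south (hz : c 2 < q)
    (h : GoesSouth q (a (c 0 / p) (c 1 / q - 1)) (a (c 0 / p) (c 1 / q))
      (c 1 % q) (c 2)) : StepsTo p q a b c (-e 1) := by
  have e0 : (c + -e 1) 0 = c 0 := by simp [e]
  have e1 : (c + -e 1) 1 = c 1 - 1 := by simp [e, sub_eq_add_neg]
  have e2 : (c + -e 1) 2 = c 2 := by simp [e]
  refine ⟨(flowDir_of_lt hz).trans (lowerDir_south h), ⟨1, Or.inr rfl⟩, ?_, by omega, by omega, ?_⟩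
  · unfold Active
    rw [e0, e1]
    have hV := (hL (c 0 / p) (c 1 / q)).active_iff
    rcases ediv_emod_sub_one hq (c 1) with ⟨d1, d2, d3⟩ | ⟨d1, d2, d3⟩ <;> rw [d2]
    · unfold GoesSouth at h; omega
    · right
      unfold GoesSouth at h; omega
  · rw [flowDir_of_lt (by omega), lowerDir_north, neg_neg]
    rw [e0, e1, e2]
    have m0 := Int.emod_nonneg (c 1) hq.ne'
    have m1 := Int.emod_lt_of_pos (c 1) hq
    rcases ediv_emod_sub_one hq (c 1) with ⟨d1, d2, d3⟩ | ⟨d1, d2, d3⟩ <;> rw [d2, d3]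
    · exact h.inside
    · exact h.next d1 h0 hz (hL (c 0 / p) (c 1 / q - 1)).vertical

omit hq in
lemma stepsTo_east (h1 : c 2 < p + q) (hz : q ≤ c 2)
    (h : GoesEast p (b (c 0 / p - 1) (c 1 / q)) (b (c 0 / p) (c 1 / q))
      (c 0 % p) (c 2 - q)) : StepsTo p q a b c (e 0) := by
  have e0 : (c + e 0) 0 = c 0 + 1 := by simp [e]
  have e1 : (c + e 0) 1 = c 1 := by simp [e]
  have e2 : (c + e 0) 2 = c 2 := by simp [e]
  refine ⟨(flowDir_of_le hz).trans (upperDir_east h), ⟨0, Or.inl rfl⟩, ?_, by omega, by omega, ?_⟩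
  · unfold Active
    rw [e0, e1]
    have hV := (hL (c 0 / p) (c 1 / q)).active_iff
    rcases ediv_emod_add_one hp (c 0) with ⟨d1, d2, d3⟩ | ⟨d1, d2, d3⟩ <;> rw [d2]
    · rw [hV]; unfold GoesEast at h; omega
    · rw [(hL _ _).active_iff]
      rw [add_sub_cancel_right]; left
      unfold GoesEast at h; omega
  · rw [flowDir_of_le (by omega), upperDir_west]
    rw [e0, e1, e2]
    have m0 := Int.emod_nonneg (c 0) hp.ne'
    have m1 := Int.emod_lt_of_pos (c 0) hp
    rcases ediv_emod_add_one hp (c 0) with ⟨d1, d2, d3⟩ | ⟨d1, d2, d3⟩ <;> rw [d2, d3]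
    · exact h.inside
    · have hN := (hL (c 0 / p + 1) (c 1 / q)).horizontal
      rw [add_sub_cancel_right] at hN ⊢
      exact h.next d1 (by omega) (by omega) hN

omit hq in
lemma stepsTo_west (h1 : c 2 < p + q) (hz : q ≤ c 2)
    (h : GoesWest p (b (c 0 / p - 1) (c 1 / q)) (b (c 0 / p) (c 1 / q))
      (c 0 % p) (c 2 - q)) : StepsTo p q a b c (-e 0) := by
  have e0 : (c + -e 0) 0 = c 0 - 1 := by simp [e, sub_eq_add_neg]
  have e1 : (c + -e 0) 1 = c 1 := by simp [e]
  have e2 : (c + -e 0) 2 = c 2 := by simp [e]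
  refine ⟨(flowDir_of_le hz).trans (upperDir_west h), ⟨0, Or.inr rfl⟩, ?_, by omega, by omega, ?_⟩
  · unfold Active
    rw [e0, e1]
    have hV := (hL (c 0 / p) (c 1 / q)).active_iff
    rcases ediv_emod_sub_one hp (c 0) with ⟨d1, d2, d3⟩ | ⟨d1, d2, d3⟩ <;> rw [d2]
    · rw [hV]; unfold GoesWest at h; omega
    · rw [(hL _ _).active_iff]
      right
      unfold GoesWest at h; omega
  · rw [flowDir_of_le (by omega), upperDir_east, neg_neg]
    rw [e0, e1, e2]
    have m0 := Int.emod_nonneg (c 0) hp.ne'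
    have m1 := Int.emod_lt_of_pos (c 0) hp
    rcases ediv_emod_sub_one hp (c 0) with ⟨d1, d2, d3⟩ | ⟨d1, d2, d3⟩ <;> rw [d2, d3]
    · exact h.inside
    · exact h.next d1 (by omega) (by omega) (hL (c 0 / p - 1) (c 1 / q)).horizontal

lemma stepsTo_lower_up (hz : c 2 < q)
    (h : LowerUp q (a (c 0 / p) (c 1 / q - 1)) (a (c 0 / p) (c 1 / q))
      (c 1 % q) (c 2)) : StepsTo p q a b c (e 2) := by
  have e0 : (c + e 2) 0 = c 0 := by simp [e]
  have e1 : (c + e 2) 1 = c 1 := by simp [e]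
  have e2 : (c + e 2) 2 = c 2 + 1 := by simp [e]
  have m0 := Int.emod_nonneg (c 0) hp.ne'
  have m0' := Int.emod_lt_of_pos (c 0) hp
  have m1 := Int.emod_nonneg (c 1) hq.ne'
  have m1' := Int.emod_lt_of_pos (c 1) hq
  have hlo : 0 ≤ c 2 + 1 := by unfold LowerUp at h; omega
  have hhi : c 2 + 1 < p + q := by unfold LowerUp at h; omega
  have hV := (hL (c 0 / p) (c 1 / q)).active_iff
  refine ⟨(flowDir_of_lt hz).trans (lowerDir_up h), ⟨2, Or.inl rfl⟩, ?_, by omega, by omega, ?_⟩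
  · unfold Active
    rw [e0, e1]
    unfold LowerUp at h; omega
  · rcases lt_or_ge (c 2 + 1) q with hz' | hz'
    · rw [flowDir_of_lt (by omega), lowerDir_down]
      rw [e0, e1, e2]
      exact h.inside
    · rw [flowDir_of_le (by omega), upperDir_down]
      rw [e0, e1, e2, show c 2 + 1 - q = 0 by omega]
      exact h.next m0 m0' (hL _ _)

lemma stepsTo_lower_down (hz : c 2 < q)
    (h : LowerDown q (a (c 0 / p) (c 1 / q - 1)) (a (c 0 / p) (c 1 / q))
      (c 1 % q) (c 2)) : StepsTo p q a b c (-e 2) := by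
  have e0 : (c + -e 2) 0 = c 0 := by simp [e]
  have e1 : (c + -e 2) 1 = c 1 := by simp [e]
  have e2 : (c + -e 2) 2 = c 2 - 1 := by simp [e, sub_eq_add_neg]
  have m0 := Int.emod_nonneg (c 0) hp.ne'
  have m0' := Int.emod_lt_of_pos (c 0) hp
  have m1 := Int.emod_nonneg (c 1) hq.ne'
  have m1' := Int.emod_lt_of_pos (c 1) hq
  -- Descending lines live strictly above a diagonal of the block, so they never reach the bottom of
  -- the box.
  have hlo : 0 ≤ c 2 - 1 := by unfold LowerDown at h; omega
  have hhi : c 2 - 1 < p + q := by unfold LowerDown at h; omega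
  have hV := (hL (c 0 / p) (c 1 / q)).active_iff
  refine ⟨(flowDir_of_lt hz).trans (lowerDir_down h), ⟨2, Or.inr rfl⟩, ?_, by omega, by omega, ?_⟩
  · unfold Active
    rw [e0, e1]
    unfold LowerDown at h; omega
  · rw [flowDir_of_lt (by omega), lowerDir_up, neg_neg]
    rw [e0, e1, e2]
    exact h.inside

lemma stepsTo_upper_up (h1 : c 2 < p + q) (hz : q ≤ c 2)
    (h : UpperUp p (b (c 0 / p - 1) (c 1 / q)) (b (c 0 / p) (c 1 / q))
      (c 0 % p) (c 2 - q)) : StepsTo p q a b c (e 2) := by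
  have e0 : (c + e 2) 0 = c 0 := by simp [e]
  have e1 : (c + e 2) 1 = c 1 := by simp [e]
  have e2 : (c + e 2) 2 = c 2 + 1 := by simp [e]
  have m0 := Int.emod_nonneg (c 0) hp.ne'
  have m0' := Int.emod_lt_of_pos (c 0) hp
  have m1 := Int.emod_nonneg (c 1) hq.ne'
  have m1' := Int.emod_lt_of_pos (c 1) hq
  have hlo : 0 ≤ c 2 + 1 := by unfold UpperUp at h; omega
  -- Likewise ascending lines turn before they reach the top.
  have hhi : c 2 + 1 < p + q := by unfold UpperUp at h; omega
  have hV := (hL (c 0 / p) (c 1 / q)).active_iff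
  refine ⟨(flowDir_of_le hz).trans (upperDir_up h), ⟨2, Or.inl rfl⟩, ?_, by omega, by omega, ?_⟩
  · unfold Active
    rw [e0, e1]
    rw [hV]; unfold UpperUp at h; omega
  · rw [flowDir_of_le (by omega), upperDir_down]
    rw [e0, e1, e2, show c 2 + 1 - q = c 2 - q + 1 by ring]
    exact h.inside

lemma stepsTo_upper_down (h1 : c 2 < p + q) (hz : q ≤ c 2)
    (h : UpperDown p (b (c 0 / p - 1) (c 1 / q)) (b (c 0 / p) (c 1 / q))
      (c 0 % p) (c 2 - q)) : StepsTo p q a b c (-e 2) := by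
  have e0 : (c + -e 2) 0 = c 0 := by simp [e]
  have e1 : (c + -e 2) 1 = c 1 := by simp [e]
  have e2 : (c + -e 2) 2 = c 2 - 1 := by simp [e, sub_eq_add_neg]
  have m0 := Int.emod_nonneg (c 0) hp.ne'
  have m0' := Int.emod_lt_of_pos (c 0) hp
  have m1 := Int.emod_nonneg (c 1) hq.ne'
  have m1' := Int.emod_lt_of_pos (c 1) hq
  have hlo : 0 ≤ c 2 - 1 := by unfold UpperDown at h; omega
  have hhi : c 2 - 1 < p + q := by unfold UpperDown at h; omega
  have hV := (hL (c 0 / p) (c 1 / q)).active_iff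
  refine ⟨(flowDir_of_le hz).trans (upperDir_down h), ⟨2, Or.inr rfl⟩, ?_, by omega, by omega, ?_⟩
  · unfold Active
    rw [e0, e1]
    rw [hV]; unfold UpperDown at h; omega
  · rcases lt_or_ge (c 2 - 1) q with hz' | hz'
    · rw [flowDir_of_lt (by omega), lowerDir_up, neg_neg]
      rw [e0, e1, e2, show c 2 - 1 = q - 1 by omega]
      exact h.next m1 m1' (hL _ _)
    · rw [flowDir_of_le (by omega), upperDir_up, neg_neg]
      rw [e0, e1, e2, show c 2 - 1 - q = c 2 - q - 1 by ring]
      exact h.inside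

include h1

lemma exists_stepsTo (hc : Active p q a c) : ∃ u, StepsTo p q a b c u := by
  have hV := hL (c 0 / p) (c 1 / q)
  rcases lt_or_ge (c 2) q with hz | hz
  · rcases lower_cases hV hc with h | h | h | h
    · exact ⟨_, stepsTo_north hp hq hL h0 hz h⟩
    · exact ⟨_, stepsTo_south hp hq hL h0 hz h⟩
    · exact ⟨_, stepsTo_lower_up hp hq hL h0 hz h⟩
    · exact ⟨_, stepsTo_lower_down hp hq hL h0 hz h⟩
  · rcases upper_cases hV (hV.active_iff.1 hc) with h | h | h | h
    · exact ⟨_, stepsTo_east hp hL h0 h1 hz h⟩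
    · exact ⟨_, stepsTo_west hp hL h0 h1 hz h⟩
    · exact ⟨_, stepsTo_upper_up hp hq hL h0 h1 hz h⟩
    · exact ⟨_, stepsTo_upper_down hp hq hL h0 h1 hz h⟩

end Flow

/-! ### Assembling a tiling of the box -/

lemma partner_apply_of_ne {i j : Fin 3} (h : j ≠ i) (c : Cube) : partner i c j = c j := by
  unfold partner; split_ifs <;> simp [e, h]

lemma partner_apply_self (i : Fin 3) (c : Cube) :
    c i % 2 = 0 ∧ partner i c i = c i + 1 ∨ c i % 2 = 1 ∧ partner i c i = c i - 1 := by
  unfold partner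
  split_ifs with h
  · left; exact ⟨Int.even_iff.1 h, by simp [e]⟩
  · right; exact ⟨Int.not_even_iff.1 h, by simp [e]⟩

lemma partner_mem_Ico {m : ℤ} (hm : Even m) {i : Fin 3} {c : Cube} (h0 : 0 ≤ c i) (h1 : c i < m) :
    0 ≤ partner i c i ∧ partner i c i < m := by
  rw [Int.even_iff] at hm
  have := partner_apply_self i c
  omega

lemma partner_ediv {m : ℤ} (hm : Even m) (hm0 : 0 < m) (i : Fin 3) (c : Cube) :
    partner i c i / m = c i / m := by
  obtain ⟨r, rfl⟩ := hm
  have h := Int.mul_ediv_add_emod (c i) (r + r)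
  have h' : (r + r) * (c i / (r + r)) = 2 * (r * (c i / (r + r))) := by ring
  rcases partner_apply_self i c with ⟨h1, h2⟩ | ⟨h1, h2⟩ <;> rw [h2]
  · rcases ediv_emod_add_one hm0 (c i) with h3 | h3 <;> omega
  · rcases ediv_emod_sub_one hm0 (c i) with h3 | h3 <;> omega

lemma lowerDir_straight {q s j k : ℤ} (hs : s = 1 ∨ s = -1) : lowerDir q s s j k = s • e 1 := by
  rcases hs with rfl | rfl
  · rw [lowerDir_north (Or.inl ⟨rfl, rfl⟩), one_smul]
  · rw [lowerDir_south (Or.inl ⟨rfl, rfl⟩), neg_smul, one_smul]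

lemma upperDir_straight {p s j k : ℤ} (hs : s = 1 ∨ s = -1) : upperDir p s s j k = s • e 0 := by
  rcases hs with rfl | rfl
  · rw [upperDir_east (Or.inl ⟨rfl, rfl⟩), one_smul]
  · rw [upperDir_west (Or.inl ⟨rfl, rfl⟩), neg_smul, one_smul]

/-- Two lines cross at the vertex `(x, y)`, both in the positive or both in the negative
direction. -/
def CrossesAt (a b : ℤ → ℤ → ℤ) (σ x y : ℤ) : Prop :=
  (σ = 1 ∨ σ = -1) ∧ a x (y - 1) = σ ∧ a x y = σ ∧ b (x - 1) y = σ ∧ b x y = σ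

lemma flowDir_of_crossesAt {p q σ : ℤ} {a b : ℤ → ℤ → ℤ} {c : Cube}
    (h : CrossesAt a b σ (c 0 / p) (c 1 / q)) :
    flowDir p q a b c = if c 2 < q then σ • e 1 else σ • e 0 := by
  obtain ⟨hσ, h1, h2, h3, h4⟩ := h
  unfold flowDir
  rw [h1, h2, h3, h4, lowerDir_straight hσ, upperDir_straight hσ]

lemma CrossesAt.neg {σ x y : ℤ} {a b : ℤ → ℤ → ℤ} (h : CrossesAt a b σ x y) :
    CrossesAt (-a) (-b) (-σ) x y := by
  obtain ⟨hσ, h1, h2, h3, h4⟩ := h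
  exact ⟨by omega, by simp [h1], by simp [h2], by simp [h3], by simp [h4]⟩

/-- A legal flow on the coarse grid gives a tiling of the union of the active columns. -/
lemma exists_isTiling_of_flow {p q : ℤ} (hp : 0 < p) (hq : 0 < q) {a b : ℤ → ℤ → ℤ}
    (hL : ∀ x y, Legal (a x (y - 1)) (a x y) (b (x - 1) y) (b x y)) (R : Finset Cube)
    (hR : ∀ c, c ∈ R ↔ Active p q a c ∧ 0 ≤ c 2 ∧ c 2 < p + q) :
    ∃ t, IsTiling R t ∧ ∀ c ∈ R, ∀ σ, CrossesAt a b σ (c 0 / p) (c 1 / q) →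
      ∃ d ∈ t, c ∈ d.cubes ∧ d.v = if c 2 < q then σ • e 1 else σ • e 0 := by
  have hL' : ∀ x y, Legal ((-a) x (y - 1)) ((-a) x y) ((-b) (x - 1) y) ((-b) x y) :=
    fun x y => (hL x y).neg
  have hact : ∀ c, Active p q (-a) c ↔ Active p q a c := by
    intro c; simp [Active]
  have step : ∀ c ∈ R, StepsTo p q a b c (flowDir p q a b c) := by
    intro c hc
    rw [hR] at hc
    obtain ⟨u, hu⟩ := exists_stepsTo hp hq hL hc.2.1 hc.2.2 hc.1
    rwa [hu.1]
  have step' : ∀ c ∈ R, StepsTo p q (-a) (-b) c (flowDir p q (-a) (-b) c) := by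
    intro c hc
    rw [hR] at hc
    obtain ⟨u, hu⟩ := exists_stepsTo hp hq hL' hc.2.1 hc.2.2 ((hact c).2 hc.1)
    rwa [hu.1]
  have hperm := exists_isTiling_of_perm R (fun c => c + flowDir p q a b c)
    (fun c => c + flowDir p q (-a) (-b) c) ?_ ?_ ?_ ?_ ?_
  · obtain ⟨t, ht, hv⟩ := hperm
    refine ⟨t, ht, fun c hc σ hσ => ?_⟩
    obtain ⟨d, hd, hcd, hv⟩ := hv c hc
    refine ⟨d, hd, hcd, ?_⟩
    rcases hv with hv | hv
    · rw [hv, add_sub_cancel_left, flowDir_of_crossesAt hσ]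
    · rw [hv, sub_add_cancel_left, flowDir_of_crossesAt hσ.neg]
      split_ifs <;> simp
  · intro c hc
    obtain ⟨-, -, h1, h2⟩ := step c hc
    exact (hR _).2 ⟨h1, h2.1, h2.2.1⟩
  · intro c hc
    obtain ⟨-, -, h1, h2⟩ := step' c hc
    exact (hR _).2 ⟨(hact _).1 h1, h2.1, h2.2.1⟩
  · intro c hc
    obtain ⟨-, -, -, -, -, h⟩ := step c hc
    simp only [h, add_neg_cancel_right]
  · intro c hc
    obtain ⟨-, -, -, -, -, h⟩ := step' c hc
    rw [neg_neg, neg_neg] at h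
    simp only [h, add_neg_cancel_right]
  · intro c hc
    simpa using (step c hc).2.1

/-- The box splits into the active columns, the inactive columns over the coarse rectangle, and the
columns outside it. The flow tiles the first part; parity pairings along suitable axes tile the
other two. -/
lemma exists_isTiling_box_of_flow {L M X Y p q : ℕ} (hp : 0 < p) (hq : 0 < q)
    {a b : ℤ → ℤ → ℤ} (hL : ∀ x y, Legal (a x (y - 1)) (a x y) (b (x - 1) y) (b x y))
    (hsupp : ∀ x y, (a x (y - 1) ≠ 0 ∨ a x y ≠ 0) → (0 ≤ x ∧ x < X) ∧ (0 ≤ y ∧ y < Y))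
    (hX : Even X) (hY : Even Y) (hXL : p * X ≤ L) (hYM : q * Y ≤ M)
    (hpq : Even p ∨ Even q ∨ Even (p + q)) (hLM : Even L ∨ Even M ∨ Even (p + q)) :
    ∃ t, IsTiling (box L M (p + q)) t ∧ ∀ c ∈ box L M (p + q), ∀ σ,
      CrossesAt a b σ (c 0 / p) (c 1 / q) →
        vecAt t c = if c 2 < q then σ • e 1 else σ • e 0 := by
  classical
  have hp' : (0 : ℤ) < p := by exact_mod_cast hp
  have hq' : (0 : ℤ) < q := by exact_mod_cast hq
  have hXL' : (p : ℤ) * X ≤ L := by exact_mod_cast hXL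
  have hYM' : (q : ℤ) * Y ≤ M := by exact_mod_cast hYM
  have hregion : ∀ c, Active p q a c →
      (0 ≤ c 0 ∧ c 0 < p * X) ∧ (0 ≤ c 1 ∧ c 1 < q * Y) := by
    intro c hc
    obtain ⟨⟨h1, h2⟩, h3, h4⟩ := hsupp _ _ hc
    refine ⟨⟨?_, ?_⟩, ?_, ?_⟩
    · by_contra h
      have := Int.ediv_neg_of_neg_of_pos (not_le.1 h) hp'
      omega
    · have := (Int.ediv_lt_iff_lt_mul hp').1 h2
      linarith
    · by_contra h
      have := Int.ediv_neg_of_neg_of_pos (not_le.1 h) hq'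
      omega
    · have := (Int.ediv_lt_iff_lt_mul hq').1 h4
      linarith
  set B := box L M (p + q)
  have hB : ∀ c, c ∈ B ↔
      (0 ≤ c 0 ∧ c 0 < L) ∧ (0 ≤ c 1 ∧ c 1 < M) ∧ (0 ≤ c 2 ∧ c 2 < (p : ℤ) + q) := by
    intro c; rw [mem_box]; push_cast; rfl
  obtain ⟨t₁, ht₁, hv⟩ := exists_isTiling_of_flow hp' hq' hL (B.filter (Active p q a)) (by
    intro c
    rw [Finset.mem_filter, hB]
    constructor
    · rintro ⟨h, h'⟩
      exact ⟨h', h.2.2⟩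
    · rintro ⟨h, h'⟩
      have := hregion c h
      exact ⟨⟨⟨this.1.1, by omega⟩, ⟨this.2.1, by omega⟩, h'⟩, h⟩)
  have h2 : ∃ t, IsTiling (B.filter fun c => ¬ Active p q a c ∧ c 0 < p * X ∧ c 1 < q * Y) t := by
    have hpX : Even ((p : ℤ) * X) := Even.mul_left (by exact_mod_cast hX) _
    have hqY : Even ((q : ℤ) * Y) := Even.mul_left (by exact_mod_cast hY) _
    -- The axis is chosen so that a pair never straddles two blocks, hence activity is preserved.
    rcases hpq with h | h | h
    · refine exists_isTiling_of_partner _ 0 fun c hc => ?_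
      have e1 : partner 0 c 1 = c 1 := partner_apply_of_ne (by decide) c
      have e2 : partner 0 c 2 = c 2 := partner_apply_of_ne (by decide) c
      have e3 := partner_ediv (m := p) (by exact_mod_cast h) hp' 0 c
      rw [Finset.mem_filter, hB] at hc ⊢
      have e4 := partner_mem_Ico hpX hc.1.1.1 hc.2.2.1
      unfold Active at hc ⊢
      rw [e1, e2, e3]
      exact ⟨⟨⟨e4.1, by omega⟩, hc.1.2⟩, hc.2.1, e4.2, hc.2.2.2⟩
    · refine exists_isTiling_of_partner _ 1 fun c hc => ?_
      have e1 : partner 1 c 0 = c 0 := partner_apply_of_ne (by decide) c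
      have e2 : partner 1 c 2 = c 2 := partner_apply_of_ne (by decide) c
      have e3 := partner_ediv (m := q) (by exact_mod_cast h) hq' 1 c
      rw [Finset.mem_filter, hB] at hc ⊢
      have e4 := partner_mem_Ico hqY hc.1.2.1.1 hc.2.2.2
      unfold Active at hc ⊢
      rw [e1, e2, e3]
      exact ⟨⟨hc.1.1, ⟨e4.1, by omega⟩, hc.1.2.2⟩, hc.2.1, hc.2.2.1, e4.2⟩
    · refine exists_isTiling_of_partner _ 2 fun c hc => ?_
      have e1 : partner 2 c 0 = c 0 := partner_apply_of_ne (by decide) c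
      have e2 : partner 2 c 1 = c 1 := partner_apply_of_ne (by decide) c
      rw [Finset.mem_filter, hB] at hc ⊢
      have e4 := partner_mem_Ico (by exact_mod_cast h) hc.1.2.2.1 hc.1.2.2.2
      unfold Active at hc ⊢
      rw [e1, e2]
      exact ⟨⟨hc.1.1, hc.1.2.1, e4⟩, hc.2⟩
  have h3 : ∃ t, IsTiling (B.filter fun c => ¬ (c 0 < p * X ∧ c 1 < q * Y)) t := by
    -- The borders of the rectangle are at even coordinates, so pairs do not straddle them.
    have hpX : ((p : ℤ) * X) % 2 = 0 :=
      Int.even_iff.1 (Even.mul_left (by exact_mod_cast hX) _)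
    have hqY : ((q : ℤ) * Y) % 2 = 0 :=
      Int.even_iff.1 (Even.mul_left (by exact_mod_cast hY) _)
    rcases hLM with h | h | h
    · refine exists_isTiling_of_partner _ 0 fun c hc => ?_
      have e1 : partner 0 c 1 = c 1 := partner_apply_of_ne (by decide) c
      have e2 : partner 0 c 2 = c 2 := partner_apply_of_ne (by decide) c
      rw [Finset.mem_filter, hB] at hc ⊢
      have e4 := partner_mem_Ico (m := L) (by exact_mod_cast h) hc.1.1.1 hc.1.1.2
      have e5 := partner_apply_self 0 c
      rw [e1, e2]
      exact ⟨⟨e4, hc.1.2⟩, by omega⟩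
    · refine exists_isTiling_of_partner _ 1 fun c hc => ?_
      have e1 : partner 1 c 0 = c 0 := partner_apply_of_ne (by decide) c
      have e2 : partner 1 c 2 = c 2 := partner_apply_of_ne (by decide) c
      rw [Finset.mem_filter, hB] at hc ⊢
      have e4 := partner_mem_Ico (m := M) (by exact_mod_cast h) hc.1.2.1.1 hc.1.2.1.2
      have e5 := partner_apply_self 1 c
      rw [e1, e2]
      exact ⟨⟨hc.1.1, e4, hc.1.2.2⟩, by omega⟩
    · refine exists_isTiling_of_partner _ 2 fun c hc => ?_
      have e1 : partner 2 c 0 = c 0 := partner_apply_of_ne (by decide) c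
      have e2 : partner 2 c 1 = c 1 := partner_apply_of_ne (by decide) c
      rw [Finset.mem_filter, hB] at hc ⊢
      have e4 := partner_mem_Ico (by exact_mod_cast h) hc.1.2.2.1 hc.1.2.2.2
      rw [e1, e2]
      exact ⟨⟨hc.1.1, hc.1.2.1, e4⟩, hc.2⟩
  obtain ⟨t₂, ht₂⟩ := h2
  obtain ⟨t₃, ht₃⟩ := h3
  have hT := (ht₁.union ht₂ ?_).union ht₃ ?_
  · have hU : (B.filter (Active p q a) ∪
        B.filter fun c => ¬ Active p q a c ∧ c 0 < p * X ∧ c 1 < q * Y) ∪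
        (B.filter fun c => ¬ (c 0 < p * X ∧ c 1 < q * Y)) = B := by
      rw [← Finset.filter_or, ← Finset.filter_or, Finset.filter_eq_self]
      intro c _
      by_cases h : Active p q a c <;> by_cases h' : c 0 < p * X ∧ c 1 < q * Y <;> simp [h, h']
    rw [hU] at hT
    refine ⟨_, hT, fun c hc σ hσ => ?_⟩
    have hact : Active p q a c := by
      obtain ⟨h, h', -⟩ := hσ
      left; omega
    obtain ⟨d, hd, hcd, hdv⟩ := hv c (Finset.mem_filter.2 ⟨hc, hact⟩) σ hσ
    rw [vecAt_eq hT (by simp [hd]) hcd, hdv]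
  · refine Finset.disjoint_filter.2 fun c _ h => ?_
    simp [h]
  · rw [← Finset.filter_or]
    refine Finset.disjoint_filter.2 fun c _ h => not_not.2 ?_
    rcases h with h | h
    · exact ⟨(hregion c h).1.2, (hregion c h).2.2⟩
    · exact h.2

/-- Each pair of a lower and an upper cube contributes `σ * σ = 1`; two cubes on the same side are
parallel and contribute nothing. -/
lemma columnTwist_of_cross {p q : ℕ} {σ : ℤ} (hσ : σ = 1 ∨ σ = -1) {f : ℤ → Vec}
    (hf : ∀ z ∈ Finset.Ico (0 : ℤ) (p + q : ℕ), f z = if z < q then σ • e 1 else σ • e 0) :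
    columnTwist (p + q) f = p * q := by
  have hσ2 : σ * σ = 1 := by rcases hσ with rfl | rfl <;> rfl
  have h1 : columnTwist (p + q) f = ∑ z₀ ∈ Finset.Ico (0 : ℤ) (p + q : ℕ),
      ∑ z₁ ∈ Finset.Ico (0 : ℤ) (p + q : ℕ),
        (if z₀ < q then 1 else 0) * (if (q : ℤ) ≤ z₁ then 1 else 0) := by
    refine Finset.sum_congr rfl fun z₀ h₀ => Finset.sum_congr rfl fun z₁ h₁ => ?_
    rw [hf z₀ h₀, hf z₁ h₁]
    by_cases h2 : z₀ < q <;> by_cases h3 : z₁ < q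
    · simp [h2, h3, cross, e]
    · rw [if_pos (by omega), if_pos h2, if_neg h3, if_pos h2, if_pos (by omega)]
      simpa [cross, e] using hσ2
    · simp [h2, cross, e]; omega
    · simp [h2, h3, cross, e]
  rw [h1, ← Finset.sum_mul_sum]
  simp only [Finset.sum_boole]
  have h2 : (Finset.Ico (0 : ℤ) (p + q : ℕ)).filter (fun z : ℤ => z < q) = Finset.Ico (0 : ℤ) (q : ℤ) := by
    ext z; simp only [Finset.mem_filter, Finset.mem_Ico]; omega
  have h3 : (Finset.Ico (0 : ℤ) (p + q : ℕ)).filter (fun z : ℤ => (q : ℤ) ≤ z) =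
      Finset.Ico (q : ℤ) (p + q : ℕ) := by
    ext z; simp only [Finset.mem_filter, Finset.mem_Ico]; omega
  rw [h2, h3]
  simp [mul_comm]

instance (s n w o : ℤ) : Decidable (Legal s n w o) := by unfold Legal; infer_instance

/-! ### Diagonal ridges and their stream function -/

/-- The possible values of a distance function on the four faces around a vertex. -/
def DistPattern (dp dq ds dt : ℤ) : Prop :=
  (dp ≤ 1 ∧ dq ≤ 1 ∧ ds ≤ 1 ∧ dt ≤ 1) ∨
  (dp = dt ∧ (dq = dp - 1 ∧ ds = dp + 1 ∨ dq = dp + 1 ∧ ds = dp - 1)) ∨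
  (dq = ds ∧ (dp = dq - 1 ∧ dt = dq + 1 ∨ dp = dq + 1 ∧ dt = dq - 1))

/-- In diagonal coordinates the distance is a maximum norm. The parity conditions exclude a tie `m =
l - v` or `m = v - r` at the vertex, so one of the two coordinates determines the distance on all
four faces around it. -/
lemma distPattern_max {m m₁ m₂ v l r : ℤ} (hm : 1 ≤ m)
    (hm' : m₁ = m - 1 ∧ m₂ = m + 1 ∨ m₁ = m + 1 ∧ m₂ = m - 1) (hlr : l ≤ r)
    (h1 : (m - (v - l)) % 2 = 1) (h2 : (m - (v - r)) % 2 = 1) :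
    DistPattern (max m (max (l - (v - 1)) (v - 1 - r))) (max m₁ (max (l - v) (v - r)))
      (max m₂ (max (l - v) (v - r))) (max m (max (l - (v + 1)) (v + 1 - r))) := by
  have upure (a1 : max (l - (v - 1)) (v - 1 - r) ≤ m) (a2 : max (l - v) (v - r) ≤ m - 1)
      (a3 : max (l - (v + 1)) (v + 1 - r) ≤ m) : DistPattern
      (max m (max (l - (v - 1)) (v - 1 - r))) (max m₁ (max (l - v) (v - r)))
      (max m₂ (max (l - v) (v - r))) (max m (max (l - (v + 1)) (v + 1 - r))) := by
    rw [max_eq_left a1, max_eq_left (a2.trans (by omega)), max_eq_left (a2.trans (by omega)),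
      max_eq_left a3]
    exact Or.inr (Or.inl (by omega))
  rcases le_or_gt v (l - 1) with hv | hv
  · have i1 : max (l - (v - 1)) (v - 1 - r) = l - (v - 1) := max_eq_left (by omega)
    have i2 : max (l - v) (v - r) = l - v := max_eq_left (by omega)
    have i3 : max (l - (v + 1)) (v + 1 - r) = l - (v + 1) := max_eq_left (by omega)
    rcases le_or_gt (l - v + 1) m with hU | hU
    · exact upure (by omega) (by omega) (by omega)
    · have hk' : m ≤ l - v - 1 := by omega
      rw [i1, i2, i3, max_eq_right (by omega : m ≤ l - (v - 1)),
        max_eq_right (by omega : m₁ ≤ l - v), max_eq_right (by omega : m₂ ≤ l - v),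
        max_eq_right (by omega : m ≤ l - (v + 1))]
      exact Or.inr (Or.inr (by omega))
  rcases le_or_gt (r + 1) v with hv' | hv'
  · have i1 : max (l - (v - 1)) (v - 1 - r) = v - 1 - r := max_eq_right (by omega)
    have i2 : max (l - v) (v - r) = v - r := max_eq_right (by omega)
    have i3 : max (l - (v + 1)) (v + 1 - r) = v + 1 - r := max_eq_right (by omega)
    rcases le_or_gt (v - r + 1) m with hU | hU
    · exact upure (by omega) (by omega) (by omega)
    · have hk' : m ≤ v - r - 1 := by omega
      rw [i1, i2, i3, max_eq_right (by omega : m ≤ v - 1 - r),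
        max_eq_right (by omega : m₁ ≤ v - r), max_eq_right (by omega : m₂ ≤ v - r),
        max_eq_right (by omega : m ≤ v + 1 - r)]
      exact Or.inr (Or.inr (by omega))
  · exact upure (max_le (by omega) (by omega)) (max_le (by omega) (by omega))
      (max_le (by omega) (by omega))

lemma distPattern_abs {U v l r : ℤ} (hlr : l ≤ r) (h1 : (U - (v - l)) % 2 = 1)
    (h2 : (U - (v - r)) % 2 = 1) :
    DistPattern (max |U| (max (l - (v - 1)) (v - 1 - r))) (max |U - 1| (max (l - v) (v - r)))
      (max |U + 1| (max (l - v) (v - r))) (max |U| (max (l - (v + 1)) (v + 1 - r))) := by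
  rcases lt_trichotomy U 0 with hU | hU | hU
  · rw [abs_of_neg hU, abs_of_neg (by omega : U - 1 < 0), abs_of_nonpos (by omega : U + 1 ≤ 0)]
    exact distPattern_max (by omega) (by omega) hlr (by omega) (by omega)
  · subst hU
    have a1 : |(0 : ℤ) - 1| = 1 := rfl
    have a2 : |(0 : ℤ) + 1| = 1 := rfl
    rw [abs_zero, a1, a2]
    rcases le_or_gt v (l - 1) with hv | hv
    · rw [max_eq_left (by omega : v - 1 - r ≤ l - (v - 1)),
        max_eq_left (by omega : v - r ≤ l - v), max_eq_left (by omega : v + 1 - r ≤ l - (v + 1)),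
        max_eq_right (by omega : 0 ≤ l - (v - 1)), max_eq_right (by omega : 1 ≤ l - v),
        max_eq_right (by omega : 0 ≤ l - (v + 1))]
      exact Or.inr (Or.inr (by omega))
    rcases le_or_gt (r + 1) v with hv' | hv'
    · rw [max_eq_right (by omega : l - (v - 1) ≤ v - 1 - r),
        max_eq_right (by omega : l - v ≤ v - r), max_eq_right (by omega : l - (v + 1) ≤ v + 1 - r),
        max_eq_right (by omega : 0 ≤ v - 1 - r), max_eq_right (by omega : 1 ≤ v - r),
        max_eq_right (by omega : 0 ≤ v + 1 - r)]
      exact Or.inr (Or.inr (by omega))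
    · refine Or.inl ⟨?_, ?_, ?_, ?_⟩ <;>
        exact max_le (by omega) (max_le (by omega) (by omega))
  · rw [abs_of_pos hU, abs_of_pos (by omega : 0 < U + 1), abs_of_nonneg (by omega : 0 ≤ U - 1)]
    exact distPattern_max (by omega) (by omega) hlr (by omega) (by omega)

/-- The profile of a ridge: zero up to `1`, rising to `W - 1`, flat between `W` and `W + 1`, and
falling back to zero at `2 * W`. -/
noncomputable def tent (W d : ℤ) : ℤ := max 0 (min (d - 1) (2 * W - d))

section Tent

variable {W d : ℤ}

lemma tent_of_le (h : d ≤ 1) : tent W d = 0 := max_eq_left (min_le_of_left_le (by omega))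

lemma tent_of_ge (h : 2 * W ≤ d) : tent W d = 0 := max_eq_left (min_le_of_right_le (by omega))

lemma tent_rising (h : 1 ≤ d) (h' : d ≤ W) : tent W d = d - 1 := by
  rw [tent, min_eq_left (by omega), max_eq_right (by omega)]

lemma tent_falling (h : W + 1 ≤ d) (h' : d ≤ 2 * W) : tent W d = 2 * W - d := by
  rw [tent, min_eq_right (by omega), max_eq_right (by omega)]

/-- The slope never jumps between `1` and `-1`: the flat parts prevent opposite bundles from meeting
head-on at a vertex. -/
lemma tent_step (hW : 2 ≤ W) (d : ℤ) :
    tent W d - tent W (d - 1) = 0 ∧ tent W (d + 1) - tent W d = 0 ∨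
    tent W d - tent W (d - 1) = 0 ∧ tent W (d + 1) - tent W d = 1 ∨
    tent W d - tent W (d - 1) = 1 ∧ tent W (d + 1) - tent W d = 1 ∨
    tent W d - tent W (d - 1) = 1 ∧ tent W (d + 1) - tent W d = 0 ∨
    tent W d - tent W (d - 1) = 0 ∧ tent W (d + 1) - tent W d = -1 ∨
    tent W d - tent W (d - 1) = -1 ∧ tent W (d + 1) - tent W d = -1 ∨
    tent W d - tent W (d - 1) = -1 ∧ tent W (d + 1) - tent W d = 0 := by
  have key : ∀ x : ℤ, (x ≤ 1 ∧ tent W x = 0) ∨ (1 ≤ x ∧ x ≤ W ∧ tent W x = x - 1) ∨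
      (W + 1 ≤ x ∧ x ≤ 2 * W ∧ tent W x = 2 * W - x) ∨ (2 * W ≤ x ∧ tent W x = 0) := by
    intro x
    rcases le_or_gt x 1 with h | h
    · exact Or.inl ⟨h, tent_of_le h⟩
    rcases le_or_gt x W with h' | h'
    · exact Or.inr (Or.inl ⟨h.le, h', tent_rising h.le h'⟩)
    rcases le_or_gt x (2 * W) with h'' | h''
    · exact Or.inr (Or.inr (Or.inl ⟨h', h'', tent_falling h' h''⟩))
    · exact Or.inr (Or.inr (Or.inr ⟨h''.le, tent_of_ge h''.le⟩))
  rcases key (d - 1) with h1 | h1 | h1 | h1 <;> rcases key d with h2 | h2 | h2 | h2 <;>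
    rcases key (d + 1) with h3 | h3 | h3 | h3 <;> omega

/-- Equal consecutive slopes give a crossing or nothing, a change to or from zero gives a turn. The
faces with distance at most `1` form the zero core, where the kink of the distance is harmless. -/
lemma legal_of_distPattern (hW : 2 ≤ W) {dp dq ds dt : ℤ} (h : DistPattern dp dq ds dt) :
    Legal (tent W dp - tent W dq) (tent W ds - tent W dt) (tent W ds - tent W dp)
      (tent W dt - tent W dq) := by
  rcases h with ⟨h1, h2, h3, h4⟩ | ⟨rfl, ⟨rfl, rfl⟩ | ⟨rfl, rfl⟩⟩ | ⟨rfl, ⟨rfl, rfl⟩ | ⟨rfl, rfl⟩⟩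
  · left
    simp [tent_of_le h1, tent_of_le h2, tent_of_le h3, tent_of_le h4]
  · rcases tent_step hW dp with h | h | h | h | h | h | h <;> obtain ⟨h1, h2⟩ := h <;>
      rw [h1, h2] <;> decide
  · have h1 := tent_step hW dp
    rw [← neg_sub (tent W (dp + 1)) (tent W dp), ← neg_sub (tent W dp) (tent W (dp - 1))]
    rcases h1 with h | h | h | h | h | h | h <;> obtain ⟨h1, h2⟩ := h <;>
      rw [h1, h2] <;> decide
  · have h1 := tent_step hW dq
    rw [← neg_sub (tent W dq) (tent W (dq - 1)), ← neg_sub (tent W (dq + 1)) (tent W dq)]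
    rcases h1 with h | h | h | h | h | h | h <;> obtain ⟨h1, h2⟩ := h <;>
      rw [h1, h2] <;> decide
  · have h1 := tent_step hW dq
    rw [← neg_sub (tent W (dq + 1)) (tent W dq), ← neg_sub (tent W dq) (tent W (dq - 1))]
    rcases h1 with h | h | h | h | h | h | h <;> obtain ⟨h1, h2⟩ := h <;>
      rw [h1, h2] <;> decide

end Tent

/-- The centre of the ridge (a closed elongated ring) to which the faces on the diagonal `u`
belong. -/
noncomputable def centre (W u : ℤ) : ℤ := (4 * W + 4) * ((u + 2 * W + 2) / (4 * W + 4))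

/-- The far end of the core of the ridge with centre `c` in the rectangle `A × B`. -/
noncomputable def farEnd (W A B c : ℤ) : ℤ := min (2 * A + c) (2 * B - c) - 4 * W - 4

/-- The height of the ridge with centre `c` in the rectangle `A × B`. -/
noncomputable def ridgeHeight (W A B c x y : ℤ) : ℤ :=
  if |c| + 4 * W ≤ farEnd W A B c then
    tent W (max |y - x - c| (max (|c| + 4 * W - (x + y)) (x + y - farEnd W A B c)))
  else 0

/-- A stream function on the faces of the rectangle `A × B`, consisting of parallel diagonal
ridges. -/
noncomputable def height (W A B x y : ℤ) : ℤ := ridgeHeight W A B (centre W (y - x)) x y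

/-- The northward flow of the stream function `height`. -/
noncomputable def northFlow (W A B x y : ℤ) : ℤ := height W A B (x - 1) y - height W A B x y

/-- The eastward flow of the stream function `height`. -/
noncomputable def eastFlow (W A B x y : ℤ) : ℤ := height W A B x y - height W A B x (y - 1)

section Height

variable {W A B c u x y : ℤ}

lemma ridgeHeight_of_far (h : 2 * W ≤ |y - x - c|) : ridgeHeight W A B c x y = 0 := by
  unfold ridgeHeight
  split_ifs
  · exact tent_of_ge (h.trans (le_max_left _ _))
  · rfl

lemma centre_bounds (hW : 0 ≤ W) (u : ℤ) :
    -(2 * W + 2) ≤ u - centre W u ∧ u - centre W u < 2 * W + 2 := by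
  have h0 : 0 < 4 * W + 4 := by omega
  have h1 := Int.mul_ediv_add_emod (u + 2 * W + 2) (4 * W + 4)
  have h2 := Int.emod_nonneg (u + 2 * W + 2) h0.ne'
  have h3 := Int.emod_lt_of_pos (u + 2 * W + 2) h0
  unfold centre
  constructor <;> linarith

/-- Strips of diagonals have width `4 * W + 4` while ridges vanish at distance `2 * W` from the
centre. Near a border between strips both ridges vanish, so the four faces at a vertex may be
computed with one common centre. -/
lemma height_eq_ridgeHeight (hW : 0 ≤ W) (h : -1 ≤ y - x - u) (h' : y - x - u ≤ 1) :
    height W A B x y = ridgeHeight W A B (centre W u) x y := by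
  unfold height
  have h1 := centre_bounds hW (y - x)
  have h2 := centre_bounds hW u
  rcases lt_trichotomy ((y - x + 2 * W + 2) / (4 * W + 4)) ((u + 2 * W + 2) / (4 * W + 4)) with
    hk | hk | hk
  · have h3 : centre W (y - x) + (4 * W + 4) ≤ centre W u := by
      unfold centre
      nlinarith [mul_le_mul_of_nonneg_left (Int.add_one_le_iff.2 hk) (by omega : 0 ≤ 4 * W + 4)]
    rw [ridgeHeight_of_far, ridgeHeight_of_far]
    · exact le_abs.2 (Or.inr (by omega))
    · exact le_abs.2 (Or.inl (by omega))
  · unfold centre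
    rw [hk]
  · have h3 : centre W u + (4 * W + 4) ≤ centre W (y - x) := by
      unfold centre
      nlinarith [mul_le_mul_of_nonneg_left (Int.add_one_le_iff.2 hk) (by omega : 0 ≤ 4 * W + 4)]
    rw [ridgeHeight_of_far, ridgeHeight_of_far]
    · exact le_abs.2 (Or.inl (by omega))
    · exact le_abs.2 (Or.inr (by omega))

lemma height_support (h : height W A B x y ≠ 0) :
    (0 ≤ x ∧ x + 2 ≤ A) ∧ (0 ≤ y ∧ y + 2 ≤ B) := by
  unfold height ridgeHeight at h
  set c := centre W (y - x)
  split_ifs at h with hc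
  · have h1 : max |y - x - c| (max (|c| + 4 * W - (x + y)) (x + y - farEnd W A B c)) < 2 * W := by
      by_contra h'
      exact h (tent_of_ge (not_lt.1 h'))
    rw [max_lt_iff, max_lt_iff, abs_lt] at h1
    have h2 := le_abs_self c
    have h3 := neg_le_abs c
    have h4 := min_le_left (2 * A + c) (2 * B - c)
    have h5 := min_le_right (2 * A + c) (2 * B - c)
    unfold farEnd at h1
    omega
  · exact absurd rfl h

lemma even_centre (W u : ℤ) : ∃ k, centre W u = 2 * k :=
  ⟨(2 * W + 2) * ((u + 2 * W + 2) / (4 * W + 4)), by unfold centre; ring⟩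

lemma legal_flow (hW : 2 ≤ W) (x y : ℤ) : Legal (northFlow W A B x (y - 1)) (northFlow W A B x y)
    (eastFlow W A B (x - 1) y) (eastFlow W A B x y) := by
  unfold northFlow eastFlow
  rw [height_eq_ridgeHeight (u := y - x) (x := x - 1) (y := y - 1) (by omega) (by omega) (by omega),
    height_eq_ridgeHeight (u := y - x) (x := x) (y := y - 1) (by omega) (by omega) (by omega),
    height_eq_ridgeHeight (u := y - x) (x := x - 1) (y := y) (by omega) (by omega) (by omega),
    height_eq_ridgeHeight (u := y - x) (x := x) (y := y) (by omega) (by omega) (by omega)]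
  obtain ⟨k, hk⟩ := even_centre W (y - x)
  set c := centre W (y - x)
  unfold ridgeHeight
  split_ifs with hc
  · apply legal_of_distPattern hW
    -- With this `v` the four faces at the vertex have coordinate sums `v - 1`, `v`, `v` and `v +
    -- 1`.
    have h := distPattern_abs (U := y - x - c) (v := x + y - 1) hc
      (by rcases abs_cases c with h | h <;> omega)
      (by unfold farEnd; rcases min_cases (2 * A + c) (2 * B - c) with h | h <;> omega)
    convert h using 3 <;> ring_nf
  · simp [Legal]

lemma flow_support (h : northFlow W A B x (y - 1) ≠ 0 ∨ northFlow W A B x y ≠ 0) :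
    (0 ≤ x ∧ x < A) ∧ (0 ≤ y ∧ y < B) := by
  unfold northFlow at h
  have h1 := height_support (W := W) (A := A) (B := B) (x := x) (y := y)
  have h2 := height_support (W := W) (A := A) (B := B) (x := x - 1) (y := y)
  have h3 := height_support (W := W) (A := A) (B := B) (x := x) (y := y - 1)
  have h4 := height_support (W := W) (A := A) (B := B) (x := x - 1) (y := y - 1)
  by_contra hcon
  have h1' : height W A B x y = 0 := by by_contra h; have := h1 h; omega
  have h2' : height W A B (x - 1) y = 0 := by by_contra h; have := h2 h; omega
  have h3' : height W A B x (y - 1) = 0 := by by_contra h; have := h3 h; omega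
  have h4' : height W A B (x - 1) (y - 1) = 0 := by by_contra h; have := h4 h; omega
  rw [h1', h2', h3', h4'] at h
  simp at h

/-- Away from the boundary of the rectangle the height depends on the diagonal only. -/
lemma height_eq_tent (hW : 2 ≤ W) (hx : 4 * W + 3 ≤ x) (hy : 4 * W + 3 ≤ y)
    (hA : x + (4 * W + 4) ≤ A) (hB : y + (4 * W + 4) ≤ B) (h : -1 ≤ y - x - u)
    (h' : y - x - u ≤ 1) :
    height W A B x y = tent W |y - x - centre W u| := by
  rw [height_eq_ridgeHeight (by omega) h h']
  have hb := centre_bounds (by omega : 0 ≤ W) u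
  set c := centre W u
  have h1 : |c| + 4 * W ≤ x + y := by
    rcases abs_cases c with h | h <;> omega
  have h2 : x + y ≤ farEnd W A B c := by
    unfold farEnd
    rcases min_cases (2 * A + c) (2 * B - c) with h | h <;> omega
  unfold ridgeHeight
  rw [if_pos (h1.trans h2), max_eq_left]
  exact (max_le (by omega) (by omega)).trans (abs_nonneg (y - x - c))

/-- On a slope all three consecutive diagonals around the vertex lie on one linear piece of `tent`,
so the four flows equal its slope with respect to `y - x`. -/
lemma exists_crossesAt (hW : 2 ≤ W) (hx : 4 * W + 4 ≤ x) (hy : 4 * W + 4 ≤ y)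
    (hA : x + (4 * W + 4) ≤ A) (hB : y + (4 * W + 4) ≤ B)
    (hu : 2 ≤ |y - x - centre W (y - x)| ∧ |y - x - centre W (y - x)| ≤ W - 1 ∨
      W + 2 ≤ |y - x - centre W (y - x)| ∧ |y - x - centre W (y - x)| ≤ 2 * W - 1) :
    ∃ σ, CrossesAt (northFlow W A B) (eastFlow W A B) σ x y := by
  unfold CrossesAt northFlow eastFlow
  rw [height_eq_tent (u := y - x) (x := x - 1) (y := y - 1) hW (by omega) (by omega) (by omega)
      (by omega) (by omega) (by omega),
    height_eq_tent (u := y - x) (x := x) (y := y - 1) hW (by omega) (by omega) (by omega)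
      (by omega) (by omega) (by omega),
    height_eq_tent (u := y - x) (x := x - 1) (y := y) hW (by omega) (by omega) (by omega)
      (by omega) (by omega) (by omega),
    height_eq_tent (u := y - x) (x := x) (y := y) hW (by omega) (by omega) (by omega)
      (by omega) (by omega) (by omega)]
  set δ := y - x - centre W (y - x) with hδ
  rw [show y - 1 - (x - 1) - centre W (y - x) = δ by rw [hδ]; ring,
    show y - 1 - x - centre W (y - x) = δ - 1 by rw [hδ]; ring,
    show y - (x - 1) - centre W (y - x) = δ + 1 by rw [hδ]; ring]
  clear_value δ
  have rise : ∀ d, 2 ≤ d → d ≤ W - 1 →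
      tent W (d - 1) = d - 2 ∧ tent W d = d - 1 ∧ tent W (d + 1) = d := by
    intro d h1 h2
    rw [tent_rising (by omega) (by omega), tent_rising (by omega) (by omega),
      tent_rising (by omega) (by omega)]
    omega
  have fall : ∀ d, W + 2 ≤ d → d ≤ 2 * W - 1 → tent W (d - 1) = 2 * W - d + 1 ∧
      tent W d = 2 * W - d ∧ tent W (d + 1) = 2 * W - d - 1 := by
    intro d h1 h2
    rw [tent_falling (by omega) (by omega), tent_falling (by omega) (by omega),
      tent_falling (by omega) (by omega)]
    omega
  rcases le_total 0 δ with h0 | h0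
  · rw [abs_of_nonneg h0] at hu ⊢
    rw [abs_of_nonneg (by omega : 0 ≤ δ - 1), abs_of_nonneg (by omega : 0 ≤ δ + 1)]
    rcases hu with ⟨h1, h2⟩ | ⟨h1, h2⟩
    · obtain ⟨e1, e2, e3⟩ := rise δ h1 h2
      exact ⟨1, by rw [e1, e2, e3]; omega⟩
    · obtain ⟨e1, e2, e3⟩ := fall δ h1 h2
      exact ⟨-1, by rw [e1, e2, e3]; omega⟩
  · rw [abs_of_nonpos h0] at hu ⊢
    rw [abs_of_nonpos (by omega : δ - 1 ≤ 0), abs_of_nonpos (by omega : δ + 1 ≤ 0),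
      show -(δ - 1) = -δ + 1 by ring, show -(δ + 1) = -δ - 1 by ring]
    rcases hu with ⟨h1, h2⟩ | ⟨h1, h2⟩
    · obtain ⟨e1, e2, e3⟩ := rise (-δ) h1 h2
      exact ⟨-1, by rw [e1, e2, e3]; omega⟩
    · obtain ⟨e1, e2, e3⟩ := fall (-δ) h1 h2
      exact ⟨1, by rw [e1, e2, e3]; omega⟩

end Height

/-! ### Counting favourable vertices -/

open Classical in
/-- The vertices away from the boundary at which two lines cross in the favourable way. -/
noncomputable def goodVertices (W m n : ℕ) : Finset (ℤ × ℤ) :=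
  (Finset.Ico (4 * W + 4 : ℤ) ((4 * W + 4) * (m + 1)) ×ˢ
    Finset.Ico (4 * W + 4 : ℤ) ((4 * W + 4) * (n + 1))).filter fun v =>
      ∃ σ, CrossesAt (northFlow W ((4 * W + 4) * (m + 2)) ((4 * W + 4) * (n + 2)))
        (eastFlow W ((4 * W + 4) * (m + 2)) ((4 * W + 4) * (n + 2))) σ v.1 v.2

lemma mem_goodVertices {W m n : ℕ} {v : ℤ × ℤ} : v ∈ goodVertices W m n ↔
    (v.1 ∈ Finset.Ico (4 * W + 4 : ℤ) ((4 * W + 4) * (m + 1)) ∧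
      v.2 ∈ Finset.Ico (4 * W + 4 : ℤ) ((4 * W + 4) * (n + 1))) ∧
    ∃ σ, CrossesAt (northFlow W ((4 * W + 4) * (m + 2)) ((4 * W + 4) * (n + 2)))
      (eastFlow W ((4 * W + 4) * (m + 2)) ((4 * W + 4) * (n + 2))) σ v.1 v.2 := by
  classical
  rw [goodVertices, Finset.mem_filter, Finset.mem_product]

/-- The offsets from the centre of a ridge at which the height is not strictly monotone. -/
def flatOffsets (W : ℤ) : List ℤ :=
  [0, 1, -1, W, -W, W + 1, -(W + 1), 2 * W, -(2 * W), 2 * W + 1, -(2 * W + 1), -(2 * W + 2)]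

lemma abs_of_not_mem_flatOffsets {W δ : ℤ} (hW : 2 ≤ W) (h : δ ∉ flatOffsets W)
    (h1 : -(2 * W + 2) ≤ δ) (h2 : δ < 2 * W + 2) :
    2 ≤ |δ| ∧ |δ| ≤ W - 1 ∨ W + 2 ≤ |δ| ∧ |δ| ≤ 2 * W - 1 := by
  simp only [flatOffsets, List.mem_cons, List.not_mem_nil, or_false, not_or] at h
  rcases abs_cases δ with h' | h' <;> omega

/-- For each `y`, every block of `P = 4 * W + 4` consecutive values of `x` meets each residue of `y
- x` once, and at most 12 residues are bad. -/
lemma le_card_goodVertices {W m n : ℕ} (hW : 2 ≤ W) :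
    n * (4 * W + 4) * (m * (4 * W + 4 - 12)) ≤ (goodVertices W m n).card := by
  set P : ℤ := 4 * W + 4 with hP
  have hP0 : 0 < P := by omega
  set S : Finset ℤ := Finset.Ico 0 P \ ((flatOffsets W).map fun k : ℤ => k + (2 * W + 2)).toFinset with hS
  have hScard : 4 * W + 4 - 12 ≤ S.card := by
    have h1 : _ ≤ S.card := Finset.le_card_sdiff ((flatOffsets W).map fun k : ℤ => k + (2 * W + 2)).toFinset
      (Finset.Ico 0 P)
    have h2 := List.toFinset_card_le ((flatOffsets W).map fun k : ℤ => k + (2 * W + 2))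
    rw [List.length_map, show (flatOffsets W).length = 12 from rfl] at h2
    rw [Int.card_Ico] at h1
    omega
  have key : ∀ s ρ y : ℤ, ρ ∈ S →
      (y - (P + P * s + (y - ρ + (2 * W + 2)) % P) + (2 * W + 2)) % P = ρ := by
    intro s ρ y hρ
    rw [hS, Finset.mem_sdiff, Finset.mem_Ico] at hρ
    have h1 := Int.mul_ediv_add_emod (y - ρ + (2 * W + 2)) P
    rw [show y - (P + P * s + (y - ρ + (2 * W + 2)) % P) + (2 * W + 2) =
      ρ + P * ((y - ρ + (2 * W + 2)) / P - 1 - s) by linear_combination -h1]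
    rw [Int.add_mul_emod_self_left]
    exact Int.emod_eq_of_lt hρ.1.1 hρ.1.2
  have hcard : ((Finset.Ico P (P * (n + 1))) ×ˢ (Finset.Ico (0 : ℤ) m ×ˢ S)).card ≤
      (goodVertices W m n).card := by
    -- The triple `(y, s, ρ)` goes to the only `x` in block `s` for which `y - x + (2 * W + 2)` has
    -- residue `ρ`.
    refine Finset.card_le_card_of_injOn
      (fun v => (P + P * v.2.1 + (v.1 - v.2.2 + (2 * W + 2)) % P, v.1)) ?_ ?_
    · rintro ⟨y, s, ρ⟩ hv
      simp only [Finset.coe_product, Set.mem_prod, Finset.mem_coe, Finset.mem_Ico] at hv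
      obtain ⟨⟨hy1, hy2⟩, ⟨hs1, hs2⟩, hρ⟩ := hv
      have hk := key s ρ y hρ
      have hr1 := Int.emod_nonneg (y - ρ + (2 * W + 2)) hP0.ne'
      have hr2 := Int.emod_lt_of_pos (y - ρ + (2 * W + 2)) hP0
      have hPs : 0 ≤ P * s := mul_nonneg hP0.le hs1
      have hPs' : P * s ≤ P * m - P := by nlinarith
      set x := P + P * s + (y - ρ + (2 * W + 2)) % P with hx
      have hδ : y - x - centre W (y - x) = ρ - (2 * W + 2) := by
        have h1 := Int.mul_ediv_add_emod (y - x + (2 * W + 2)) P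
        rw [hk] at h1
        unfold centre
        rw [← hP, show y - x + 2 * (W : ℤ) + 2 = y - x + (2 * W + 2) by ring]
        linarith
      have hρ' := hρ
      rw [hS, Finset.mem_sdiff, Finset.mem_Ico, List.mem_toFinset, List.mem_map] at hρ'
      obtain ⟨⟨hρ1, hρ2⟩, hρ3⟩ := hρ'
      have hx1 : P ≤ x := by linarith
      have hx2 : x < P * (m + 1) := by linarith
      refine Finset.mem_coe.2 (mem_goodVertices.2 ⟨
        ⟨Finset.mem_Ico.2 ⟨hx1, hx2⟩, Finset.mem_Ico.2 ⟨hy1, hy2⟩⟩, ?_⟩)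
      refine exists_crossesAt (by exact_mod_cast hW) hx1 hy1 (by linarith) (by linarith) ?_
      rw [hδ]
      refine abs_of_not_mem_flatOffsets (by exact_mod_cast hW) (fun h => ?_) (by omega) (by omega)
      exact hρ3 ⟨_, h, by ring⟩
    · rintro ⟨y, s, ρ⟩ hv ⟨y', s', ρ'⟩ hv' heq
      simp only [Finset.coe_product, Set.mem_prod, Finset.mem_coe] at hv hv'
      simp only [Prod.mk.injEq] at heq
      obtain ⟨h1, rfl⟩ := heq
      have hρ : ρ = ρ' := by
        rw [← key s ρ y hv.2.2, h1, key s' ρ' y hv'.2.2]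
      subst hρ
      have hs : P * s = P * s' := by linarith
      rw [mul_right_inj' hP0.ne'] at hs
      rw [hs]
  refine le_trans ?_ hcard
  rw [Finset.card_product, Finset.card_product, Int.card_Ico, Int.card_Ico,
    show P * (n + 1) - P = ((n * (4 * W + 4) : ℕ) : ℤ) by push_cast; rw [hP]; ring,
    Int.toNat_natCast, sub_zero, Int.toNat_natCast]
  gcongr

/-- A lower bound for the maximal twist in terms of the number of favourable columns. -/
lemma le_maxtw {L M p q m n W : ℕ} (hW : 2 ≤ W) (hp : 0 < p) (hpq : q = p ∨ q = p + 1)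
    (hL : p * ((4 * W + 4) * (m + 2)) ≤ L) (hM : q * ((4 * W + 4) * (n + 2)) ≤ M)
    (hLM : Even L ∨ Even M ∨ Even (p + q)) :
    (2 * ((p : ℝ) * q * (n * (4 * W + 4) * (m * (4 * W + 4 - 12)))) - L * M) * (p * q) / 4 ≤
      maxtw L M (p + q) := by
  classical
  have hq : 0 < q := by omega
  have hp' : (0 : ℤ) < p := by exact_mod_cast hp
  have hq' : (0 : ℤ) < q := by exact_mod_cast hq
  have heven : ∀ k : ℕ, Even ((4 * W + 4) * k) := fun k =>
    Even.mul_right ⟨2 * W + 2, by ring⟩ k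
  have hpar : Even p ∨ Even q ∨ Even (p + q) := by
    rcases hpq with rfl | rfl
    · exact Or.inr (Or.inr ⟨q, rfl⟩)
    · rcases Nat.even_or_odd p with h | h
      · exact Or.inl h
      · exact Or.inr (Or.inl h.add_one)
  obtain ⟨t, ht, hvec⟩ := exists_isTiling_box_of_flow (L := L) (M := M)
    (X := (4 * W + 4) * (m + 2)) (Y := (4 * W + 4) * (n + 2)) hp hq
    (legal_flow (A := (4 * W + 4) * (m + 2)) (B := (4 * W + 4) * (n + 2))
      (by exact_mod_cast hW : (2 : ℤ) ≤ W))
    (fun x y h => by push_cast; exact flow_support h) (heven _) (heven _) hL hM hpar hLM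
  set Gc := goodVertices W m n with hGc
  -- A favourable vertex together with an offset in its block is a favourable column.
  set φ : (ℤ × ℤ) × (ℤ × ℤ) → ℤ × ℤ := fun v => (p * v.1.1 + v.2.1, q * v.1.2 + v.2.2) with hφ
  set D := Gc ×ˢ (Finset.Ico (0 : ℤ) p ×ˢ Finset.Ico (0 : ℤ) q) with hD
  have hdiv : ∀ {r : ℤ}, 0 < r → ∀ {x i : ℤ}, 0 ≤ i → i < r →
      (r * x + i) / r = x ∧ (r * x + i) % r = i := fun hr x i h0 h1 =>
    (Int.ediv_emod_unique hr).2 ⟨by ring, h0, h1⟩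
  have hinj : Set.InjOn φ D := by
    rintro ⟨⟨x, y⟩, i, j⟩ hv ⟨⟨x', y'⟩, i', j'⟩ hv' heq
    simp only [hD, Finset.coe_product, Set.mem_prod, Finset.mem_coe, Finset.mem_Ico] at hv hv'
    simp only [hφ, Prod.mk.injEq] at heq
    have h1 := hdiv hp' (x := x) hv.2.1.1 hv.2.1.2
    have h2 := hdiv hq' (x := y) hv.2.2.1 hv.2.2.2
    have h1' := hdiv hp' (x := x') hv'.2.1.1 hv'.2.1.2
    have h2' := hdiv hq' (x := y') hv'.2.2.1 hv'.2.2.2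
    rw [heq.1] at h1
    rw [heq.2] at h2
    rw [← h1.1, ← h1.2, ← h2.1, ← h2.2, h1'.1, h1'.2, h2'.1, h2'.2]
  have hLZ : (p : ℤ) * ((4 * W + 4) * (m + 2)) ≤ L := by exact_mod_cast hL
  have hMZ : (q : ℤ) * ((4 * W + 4) * (n + 2)) ≤ M := by exact_mod_cast hM
  have hmem : ∀ x y i j : ℤ, ((x, y), i, j) ∈ D →
      (x, y) ∈ Gc ∧ (0 ≤ i ∧ i < p) ∧ (0 ≤ j ∧ j < q) ∧
      (0 ≤ p * x + i ∧ p * x + i < L) ∧ (0 ≤ q * y + j ∧ q * y + j < M) := by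
    intro x y i j h
    simp only [hD, Finset.mem_product, Finset.mem_Ico] at h
    obtain ⟨h1, hi, hj⟩ := h
    have h2 := h1
    rw [hGc, mem_goodVertices, Finset.mem_Ico, Finset.mem_Ico] at h2
    obtain ⟨⟨⟨hx1, hx2⟩, hy1, hy2⟩, -⟩ := h2
    have hx : (p : ℤ) * (x + 1) ≤ p * ((4 * W + 4) * (m + 2)) :=
      mul_le_mul_of_nonneg_left (by linarith) hp'.le
    have hy : (q : ℤ) * (y + 1) ≤ q * ((4 * W + 4) * (n + 2)) :=
      mul_le_mul_of_nonneg_left (by linarith) hq'.le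
    have hx0 : 0 ≤ (p : ℤ) * x := mul_nonneg hp'.le (by linarith)
    have hy0 : 0 ≤ (q : ℤ) * y := mul_nonneg hq'.le (by linarith)
    exact ⟨h1, hi, hj, ⟨by linarith, by linarith⟩, by linarith, by linarith⟩
  have hN2 : (p + q) / 2 = p := by omega
  have hN2' : p + q - p = q := by omega
  have htw := le_twist ht (D.image φ) ?_ ?_
  · rw [hN2, hN2', Finset.card_image_of_injOn hinj] at htw
    refine le_trans ?_ (htw.trans ((isGreatest_maxtw L M (p + q) hLM).2 ⟨t, ht, rfl⟩))
    gcongr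
    have h1 : (D.card : ℝ) = Gc.card * (p * q) := by
      rw [hD, Finset.card_product, Finset.card_product]
      simp
    have h2 : ((n * (4 * W + 4) * (m * (4 * W + 4 - 12)) : ℕ) : ℝ) ≤ (Gc.card : ℝ) :=
      Nat.cast_le.2 (le_card_goodVertices hW)
    rw [Nat.cast_mul, Nat.cast_mul, Nat.cast_mul, Nat.cast_sub (by omega)] at h2
    push_cast at h2
    rw [h1, mul_comm]
    gcongr
  · intro g hg
    rw [Finset.mem_image] at hg
    obtain ⟨⟨⟨x, y⟩, i, j⟩, hv, rfl⟩ := hg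
    obtain ⟨-, -, -, hx, hy⟩ := hmem x y i j hv
    exact Finset.mem_product.2 ⟨Finset.mem_Ico.2 hx, Finset.mem_Ico.2 hy⟩
  · intro g hg
    rw [Finset.mem_image] at hg
    obtain ⟨⟨⟨x, y⟩, i, j⟩, hv, rfl⟩ := hg
    obtain ⟨hG, hi, hj, hx, hy⟩ := hmem x y i j hv
    obtain ⟨-, σ, hσ⟩ := mem_goodVertices.1 hG
    rw [hN2, hN2']
    refine columnTwist_of_cross hσ.1 fun z hz => ?_
    refine hvec ![p * x + i, q * y + j, z] (mem_box.2 ⟨hx, hy, Finset.mem_Ico.1 hz⟩) σ ?_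
    have e0 : (![p * x + i, q * y + j, z] : Cube) 0 / p = x := (hdiv hp' hi.1 hi.2).1
    have e1 : (![p * x + i, q * y + j, z] : Cube) 1 / q = y := (hdiv hq' hj.1 hj.2).1
    rw [e0, e1]
    exact hσ

/-! ### Uniform estimate and the two limits -/

/-- The limit density of the maximal twist of boxes of height `N`. -/
noncomputable def density (N : ℕ) : ℝ :=
  ((N / 2 : ℕ) : ℝ) * ((N - N / 2 : ℕ) : ℝ) / (4 * (N : ℝ) ^ 2)

lemma maxtw_le {L M N : ℕ} (h : Even L ∨ Even M ∨ Even N) :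
    maxtw L M N ≤ L * M * ((N / 2 : ℕ) * (N - N / 2 : ℕ)) / 4 := by
  obtain ⟨t, ht, htw⟩ := (isGreatest_maxtw L M N h).1
  rw [← htw]
  exact twist_le ht

/-- Rounding down to a multiple of `k`, up to a margin, loses little. -/
lemma exists_mul_le {k K L : ℕ} {δ : ℝ} (hk : 0 < k) (hK : 3 ≤ δ * K) (hK' : 3 ≤ K)
    (hL : K * k ≤ L) : ∃ m : ℕ, k * (m + 2) ≤ L ∧ (1 - δ) * L ≤ k * m := by
  have h1 : K ≤ L / k := (Nat.le_div_iff_mul_le hk).2 hL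
  refine ⟨L / k - 2, ?_, ?_⟩
  · rw [Nat.sub_add_cancel (by omega), mul_comm]
    exact Nat.div_mul_le_self L k
  · have h2 : L < k * (L / k + 1) := by
      have := Nat.lt_div_mul_add hk (a := L)
      rw [mul_add, mul_comm k]; omega
    obtain ⟨m, hm⟩ : ∃ m, L / k = m + 2 := ⟨L / k - 2, by omega⟩
    rw [hm, Nat.add_sub_cancel]
    rw [hm] at h2
    have h3 : (L : ℝ) ≤ k * (m + 3) := by exact_mod_cast h2.le
    have h4 : (K : ℝ) * k ≤ L := by exact_mod_cast hL
    have h5 : (0 : ℝ) < k := by exact_mod_cast hk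
    have h6 : (0 : ℝ) < K := by positivity
    have hδ : 0 ≤ δ := by
      by_contra h
      nlinarith
    have h7 : δ * (K * k) ≤ δ * L := mul_le_mul_of_nonneg_left h4 hδ
    nlinarith

/-- `K` is independent of `N`: the ridge width depends on `ε` only, and blocks have sides at most
`N`. -/
lemma exists_bound_maxtw {ε : ℝ} (hε : 0 < ε) (hε1 : ε ≤ 1) : ∃ K : ℕ, ∀ N L M : ℕ, 2 ≤ N →
    K * N ≤ L → K * N ≤ M → (Even L ∨ Even M ∨ Even N) →
    |maxtw L M N / ((L : ℝ) * (M : ℝ) * (N : ℝ) ^ 2) - density N| ≤ ε := by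
  -- Three losses of a factor `1 - δ` (rounding `L`, rounding `M`, bad diagonals) leave at least `1
  -- - 3 * δ`; bad columns count twice, hence `6 * δ = ε`.
  set δ : ℝ := ε / 6 with hδ
  have hδ0 : 0 < δ := by positivity
  have hδ1 : δ ≤ 1 / 6 := by rw [hδ]; linarith
  obtain ⟨W, hW⟩ := exists_nat_gt (3 / δ + 2)
  have hW' : 3 < δ * W := by
    have : 3 / δ < W := by linarith
    rwa [div_lt_iff₀' hδ0] at this
  have hW2 : 2 ≤ W := by
    have : (2 : ℝ) < W := by
      have : 0 < 3 / δ := by positivity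
      linarith
    exact_mod_cast this.le
  obtain ⟨K₀, hK₀⟩ := exists_nat_ge (3 / δ + 3)
  have hK3 : 3 ≤ δ * K₀ := by
    have : 3 / δ ≤ K₀ := by linarith
    rwa [div_le_iff₀' hδ0] at this
  have hK3' : 3 ≤ K₀ := by
    have : (3 : ℝ) ≤ K₀ := by
      have : 0 < 3 / δ := by positivity
      linarith
    exact_mod_cast this
  refine ⟨K₀ * (4 * W + 4), fun N L M hN hL hM hLM => ?_⟩
  obtain ⟨p, hp⟩ : ∃ p, p = N / 2 := ⟨_, rfl⟩
  obtain ⟨q, hq⟩ : ∃ q, q = N - N / 2 := ⟨_, rfl⟩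
  have hpq : N = p + q := by omega
  have hp0 : 0 < p := by omega
  have hq0 : 0 < q := by omega
  have hsize : ∀ r ≤ N, ∀ X, K₀ * (4 * W + 4) * N ≤ X → K₀ * (r * (4 * W + 4)) ≤ X := by
    intro r hr X hX
    refine le_trans ?_ hX
    rw [mul_assoc, mul_comm r]
    gcongr
  obtain ⟨m, hm1, hm2⟩ := exists_mul_le (k := p * (4 * W + 4)) (by positivity) hK3 hK3'
    (hsize p (by omega) L hL)
  obtain ⟨n, hn1, hn2⟩ := exists_mul_le (k := q * (4 * W + 4)) (by positivity) hK3 hK3'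
    (hsize q (by omega) M hM)
  rw [mul_assoc] at hm1 hn1
  have hlow := le_maxtw hW2 hp0 (by omega) hm1 hn1 (by rwa [← hpq])
  have hup := maxtw_le hLM
  rw [← hq, ← hp] at hup
  rw [← hpq] at hlow
  push_cast at hm2 hn2
  have hN0 : (0 : ℝ) < N := by positivity
  have hKN : 0 < K₀ * (4 * W + 4) * N := by positivity
  have hL0 : (0 : ℝ) < L := by exact_mod_cast hKN.trans_le hL
  have hM0 : (0 : ℝ) < M := by exact_mod_cast hKN.trans_le hM
  have hp0' : (0 : ℝ) < p := by exact_mod_cast hp0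
  have hq0' : (0 : ℝ) < q := by exact_mod_cast hq0
  have hW0 : (0 : ℝ) < W := by positivity
  have hcount : (1 - 3 * δ) * (L * M) ≤
      (p : ℝ) * q * (n * (4 * W + 4) * (m * (4 * W + 4 - 12))) := by
    -- This amounts to `12 ≤ δ * (4 * W + 4)`, which dictated the choice of `W`.
    have h1 : (1 - δ) * (4 * W + 4) ≤ (4 * (W : ℝ) + 4 - 12) := by linarith
    have h2 : ((1 - δ) * L) * ((1 - δ) * M) * (1 - δ) * (4 * W + 4) ≤
        (p * (4 * W + 4) * m) * (q * (4 * W + 4) * n) * (4 * (W : ℝ) + 4 - 12) := by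
      have h3 : 0 ≤ (1 - δ) * L := mul_nonneg (by linarith) hL0.le
      have h4 : 0 ≤ (1 - δ) * M := mul_nonneg (by linarith) hM0.le
      have h5 := mul_le_mul hm2 hn2 h4 (h3.trans hm2)
      have h6 := mul_le_mul h5 h1 (mul_nonneg (by linarith) (by positivity))
        ((mul_nonneg h3 h4).trans h5)
      linarith
    have h3 : (1 - 3 * δ) * (L * M) ≤ (1 - δ) ^ 3 * (L * M) := by
      gcongr
      nlinarith [sq_nonneg δ]
    have h4 : (1 - δ) ^ 3 * (L * M) * (4 * W + 4) ≤
        (p : ℝ) * q * (n * (4 * W + 4) * (m * (4 * W + 4 - 12))) * (4 * W + 4) := by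
      linarith
    exact h3.trans (le_of_mul_le_mul_right h4 (by positivity))
  have hlow' : (1 - ε) * (L * M * (p * q) / 4) ≤ maxtw L M N := by
    refine le_trans ?_ hlow
    have : (1 - ε) * (L * M) ≤
        2 * ((p : ℝ) * q * (n * (4 * W + 4) * (m * (4 * W + 4 - 12)))) - L * M := by
      rw [hδ] at hcount; linarith
    have := mul_le_mul_of_nonneg_right this (by positivity : 0 ≤ (p : ℝ) * q / 4)
    linarith
  have hdens : density N = (L * M * (p * q) / 4) / ((L : ℝ) * (M : ℝ) * (N : ℝ) ^ 2) := by
    rw [density, ← hq, ← hp]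
    field_simp
  have hpqN : (p : ℝ) * q ≤ N ^ 2 := by
    rw [hpq]; push_cast; nlinarith
  have hden : 0 < (L : ℝ) * (M : ℝ) * (N : ℝ) ^ 2 := by positivity
  rw [hdens, ← sub_div, abs_div, abs_of_pos hden, div_le_iff₀ hden, abs_le]
  have hfrac : ε * (L * M * (p * q) / 4) ≤ ε * (L * M * N ^ 2) := by
    have : (L : ℝ) * M * (p * q) ≤ L * M * N ^ 2 := by gcongr
    have h0 : 0 ≤ (L : ℝ) * M * (p * q) := by positivity
    gcongr
    linarith
  constructor
  · linarith
  · have : 0 ≤ ε * (L * M * N ^ 2) := by positivity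
    linarith

lemma density_eq (N : ℕ) :
    density N = (⌈(N : ℝ) / 2⌉ : ℝ) * (⌊(N : ℝ) / 2⌋ : ℝ) / (4 * (N : ℝ) ^ 2) := by
  have hfloor : ⌊(N : ℝ) / 2⌋ = ((N / 2 : ℕ) : ℤ) := by
    rw [Int.floor_eq_iff]
    have h1 : 2 * (N / 2) ≤ N := by omega
    have h2 : N < 2 * (N / 2) + 2 := by omega
    have h1' : 2 * ((N / 2 : ℕ) : ℝ) ≤ N := by exact_mod_cast h1
    have h2' : (N : ℝ) < 2 * ((N / 2 : ℕ) : ℝ) + 2 := by exact_mod_cast h2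
    rw [Int.cast_natCast]
    constructor <;> linarith
  have hceil : ⌈(N : ℝ) / 2⌉ = ((N - N / 2 : ℕ) : ℤ) := by
    rw [Int.ceil_eq_iff]
    have h1 : N ≤ 2 * (N - N / 2) := by omega
    have h2 : 2 * (N - N / 2) < N + 2 := by omega
    have h1' : (N : ℝ) ≤ 2 * ((N - N / 2 : ℕ) : ℝ) := by exact_mod_cast h1
    have h2' : 2 * ((N - N / 2 : ℕ) : ℝ) < N + 2 := by exact_mod_cast h2
    rw [Int.cast_natCast]
    constructor <;> linarith
  rw [hfloor, hceil, Int.cast_natCast, Int.cast_natCast, density, mul_comm ((N / 2 : ℕ) : ℝ)]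

/-- The difference is zero for even `N` and `-1 / (16 * N ^ 2)` for odd `N`. -/
lemma abs_density_sub_le {N : ℕ} (hN : 2 ≤ N) : |density N - 1 / 16| ≤ 1 / N := by
  have hN0 : (2 : ℝ) ≤ N := by exact_mod_cast hN
  unfold density
  obtain ⟨k, hk | hk⟩ := Nat.even_or_odd' N
  · have h1 : N / 2 = k := by omega
    have h2 : N - k = k := by omega
    rw [h1, h2]
    have hk' : (N : ℝ) = 2 * k := by exact_mod_cast hk
    rw [hk'] at hN0 ⊢
    have hk0 : (0 : ℝ) < k := by linarith
    have : (k : ℝ) * k / (4 * (2 * k) ^ 2) - 1 / 16 = 0 := by field_simp; ring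
    rw [this, abs_zero]
    positivity
  · have h1 : N / 2 = k := by omega
    have h2 : N - k = k + 1 := by omega
    rw [h1, h2]
    have hk' : (N : ℝ) = 2 * k + 1 := by exact_mod_cast hk
    rw [hk'] at hN0 ⊢
    have hk0 : (0 : ℝ) < 2 * k + 1 := by linarith
    have : (k : ℝ) * (k + 1 : ℕ) / (4 * (2 * k + 1) ^ 2) - 1 / 16 =
        -(1 / (16 * (2 * k + 1) ^ 2)) := by
      push_cast; field_simp; ring
    rw [this, abs_neg, abs_of_pos (by positivity)]
    apply one_div_le_one_div_of_le hk0
    nlinarith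

lemma exists_abs_maxtw_sub_le {ε : ℝ} (hε : 0 < ε) : ∃ K : ℕ, ∀ N L M : ℕ, 2 ≤ N →
    K * N ≤ L → K * N ≤ M → (Even L ∨ Even M ∨ Even N) →
    |maxtw L M N / ((L : ℝ) * (M : ℝ) * (N : ℝ) ^ 2) - density N| ≤ ε := by
  obtain ⟨K, hK⟩ := exists_bound_maxtw (lt_min hε one_pos) (min_le_right ε 1)
  exact ⟨K, fun N L M hN hL hM h => (hK N L M hN hL hM h).trans (min_le_left _ _)⟩

end DominoBrick

theorem mainTheorem8 :
    (∀ N : ℕ, 2 ≤ N →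
      Tendsto
        (fun p : ℕ × ℕ =>
          DominoBrick.maxtw p.1 p.2 N / ((p.1 : ℝ) * (p.2 : ℝ) * (N : ℝ) ^ 2))
        ((atTop ×ˢ atTop) ⊓ 𝓟 {p : ℕ × ℕ | Even p.1 ∨ Even p.2 ∨ Even N})
        (𝓝 ((⌈(N : ℝ) / 2⌉ : ℝ) * (⌊(N : ℝ) / 2⌋ : ℝ) / (4 * (N : ℝ) ^ 2)))) ∧
    Tendsto
      (fun q : ℕ × ℝ × ℝ =>
        DominoBrick.maxtw ⌊q.2.1 * (q.1 : ℝ)⌋₊ ⌊q.2.2 * (q.1 : ℝ)⌋₊ q.1 /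
          ((⌊q.2.1 * (q.1 : ℝ)⌋₊ : ℝ) * (⌊q.2.2 * (q.1 : ℝ)⌋₊ : ℝ) * (q.1 : ℝ) ^ 2))
      ((atTop ×ˢ atTop ×ˢ atTop) ⊓
        𝓟 {q : ℕ × ℝ × ℝ |
          Even ⌊q.2.1 * (q.1 : ℝ)⌋₊ ∨ Even ⌊q.2.2 * (q.1 : ℝ)⌋₊ ∨ Even q.1})
      (𝓝 (1 / 16)) := by
  constructor
  · intro N hN
    rw [← DominoBrick.density_eq, Metric.tendsto_nhds]
    intro ε hε
    obtain ⟨K, hK⟩ := DominoBrick.exists_abs_maxtw_sub_le (half_pos hε)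
    rw [eventually_inf_principal]
    filter_upwards [(eventually_ge_atTop (K * N)).prod_mk (eventually_ge_atTop (K * N))]
      with v hv hpar
    rw [Real.dist_eq]
    exact (hK N v.1 v.2 hN hv.1 hv.2 hpar).trans_lt (half_lt_self hε)
  · rw [Metric.tendsto_nhds]
    intro ε hε
    obtain ⟨K, hK⟩ := DominoBrick.exists_abs_maxtw_sub_le (half_pos hε)
    obtain ⟨N₀, hN₀⟩ := exists_nat_gt (2 / ε)
    rw [eventually_inf_principal]
    filter_upwards [(eventually_ge_atTop (max 2 N₀)).prod_mk
      ((eventually_ge_atTop (K : ℝ)).prod_mk (eventually_ge_atTop (K : ℝ)))] with v hv hpar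
    obtain ⟨hN, hl, hm⟩ := hv
    have hN2 : 2 ≤ v.1 := (le_max_left _ _).trans hN
    -- Here `λ, μ ≥ K` turns the second limit into an instance of the uniform estimate.
    have hfloor : ∀ x : ℝ, (K : ℝ) ≤ x → K * v.1 ≤ ⌊x * (v.1 : ℝ)⌋₊ := by
      intro x hx
      apply Nat.le_floor
      push_cast
      gcongr
    have h1 := hK v.1 _ _ hN2 (hfloor _ hl) (hfloor _ hm) hpar
    have h2 := DominoBrick.abs_density_sub_le hN2
    have h3 : 1 / (v.1 : ℝ) < ε / 2 := by
      have h4 : (N₀ : ℝ) ≤ v.1 := by exact_mod_cast (le_max_right _ _).trans hN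
      have h5 : 2 / ε < v.1 := hN₀.trans_le h4
      have h6 : (0 : ℝ) < v.1 := (by positivity : 0 < 2 / ε).trans h5
      rw [div_lt_iff₀ hε] at h5
      rw [div_lt_iff₀ h6]
      linarith
    rw [Real.dist_eq]
    calc _ ≤ _ := abs_sub_le _ (DominoBrick.density v.1) _
      _ < ε := by linarith
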